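/- Let $(W,S)$ be a Coxeter system ($S$ and $W$ may be infinite), let $\Gamma$ be an abelian group with a total order compatible with the group law, and let $\varphi : S \to \Gamma$ be a map that is constant on $W$-conjugacy classes in $S$. Let $H(W,S,\varphi)$ be the Hecke algebra: the free $\mathbb Z[\Gamma]$-module with basis $(T_w)_{w\in W}$ and the associative multiplication determined by $T_wT_{w'}=T_{ww'}$ if $\ell(ww')=\ell(w)+\ell(w')$, and $(T_s-e^{\varphi(s)})(T_s+e^{-\varphi(s)})=0$ for $s\in S$. Let $h\mapsto\overline h$ be its antilinear involution with $\overline{e^\gamma}=e^{-\gamma}$ and $\overline{T_w}=T_{w^{-1}}^{-1}$, and let $C_w=C_w^{\varphi}$ be the Kazhdan–Lusztig element, that is, the unique element with $\overline{C_w}=C_w$ and $C_w-T_w\in\bigoplus_{y\in W}\mathbb Z[\Gamma_{<0}]\,T_y$. Let $S=I\,\dot\cup\,J$ be a partition such that no element of $I$ is conjugate in $W$ to an element of $J$. Let $W_I=\langle I\rangle$, let $\tilde J=\{xtx^{-1} : x\in W_I,\ t\in J\}$ and $\tilde W=\langle\tilde J\rangle$. Then $(\tilde W,\tilde J)$ is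 a Coxeter system, and $\tilde\varphi(xtx^{-1})=\varphi(t)$ ($x\in W_I$, $t\in J$) defines a map $\tilde\varphi:\tilde J\to\Gamma$ that is constant on $\tilde W$-conjugacy classes. The group $W_I$ acts on $H(\tilde W,\tilde J,\tilde\varphi)$ by $x(T_w)=T_{xwx^{-1}}$, and $W_I\ltimes H(\tilde W,\tilde J,\tilde\varphi)$ denotes the corresponding semidirect product of algebras, in which $x\cdot h\cdot x^{-1}=x(h)$. Suppose that $\varphi(s)=0$ for all $s\in I$. Then: (a) $\tilde{\mathcal H}=\bigoplus_{w\in\tilde W}\mathbb Z[\Gamma]\,T_w^{\varphi}$ is a subalgebra of $H(W,S,\varphi)$. (b) The unique $\mathbb Z[\Gamma]$-linear map $\theta:W_I\ltimes H(\tilde W,\tilde J,\tilde\varphi)\to H(W,S,\varphi)$ with $\theta(x\cdot T_w^{\tilde\varphi})=T_{xw}^{\varphi}$ for $x\in W_I$ and $w\in\tilde W$ is an isomorphism of $\mathbb Z[\Gamma]$-algebras. It maps $H(\tilde W,\tilde J,\tilde\varphi)$ isomorphically onto $\tilde{\mathcal H}$. (c) If $x\in W_I$ and $w\in W$, then $C_x^\varphi=T_x^\varphi$,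 $C_{xw}^\varphi=T_x^\varphi C_w^\varphi$ and $C_{wx}^\varphi=C_w^\varphi T_x^\varphi$. If moreover $w\in\tilde W$, then $\theta(C_w^{\tilde\varphi})=C_w^\varphi$. -/

import Mathlib

namespace KLHecke

section Exchange

theorem end_mul_apply {α : Type*} (f g : Function.End α) (p : α) : (f * g) p = f (g p) := rfl

theorem end_one_apply {α : Type*} (p : α) : (1 : Function.End α) p = p := rfl

variable {B W : Type*} [Group W] {M : CoxeterMatrix B} (cs : CoxeterSystem M W)

open Classical in
/-- The operator `(t, ε) ↦ (s t s, ε + [t = s])` on `W × ℤ/2`, for `s` a simple reflection. -/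
noncomputable def signOp (i : B) : Function.End (W × ZMod 2) :=
  fun p => (cs.simple i * p.1 * cs.simple i, p.2 + if p.1 = cs.simple i then 1 else 0)

theorem signOp_pow (i j : B) (k : ℕ) (p : W × ZMod 2) :
    ((signOp cs i * signOp cs j) ^ k) p =
      ((cs.simple i * cs.simple j) ^ k * p.1 * ((cs.simple i * cs.simple j) ^ k)⁻¹,
        p.2 + ∑ m ∈ Finset.range (2 * k),
          open Classical in
          if p.1 = cs.simple j * (cs.simple i * cs.simple j) ^ m then 1 else 0) := by
  classical
  induction k with
  | zero => simp [end_one_apply]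
  | succ k ih =>
    set r := cs.simple i * cs.simple j with hr
    have hj : cs.simple j * cs.simple j = 1 := cs.simple_mul_simple_self j
    have hi : cs.simple i * cs.simple i = 1 := cs.simple_mul_simple_self i
    have hrinv : r⁻¹ = cs.simple j * cs.simple i := by simp [hr]
    have key : ∀ m : ℕ, cs.simple j * r ^ m = (r ^ m)⁻¹ * cs.simple j := by
      intro m
      induction m with
      | zero => simp
      | succ m ihm =>
        have h1 : cs.simple j * r = r⁻¹ * cs.simple j := by rw [hrinv, hr]; group
        rw [pow_succ, ← mul_assoc, ihm, mul_assoc, h1, ← mul_assoc, ← mul_inv_rev, ← pow_succ',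
          ← pow_succ]
    rw [pow_succ', end_mul_apply, ih]
    simp only [end_mul_apply, signOp]
    have e1 : (r ^ k * p.1 * (r ^ k)⁻¹ = cs.simple j) ↔ p.1 = cs.simple j * r ^ (2 * k) := by
      rw [two_mul, pow_add, ← mul_assoc, key]
      constructor
      · intro h; rw [← h]; group
      · intro h; rw [h]; group
    have e2 : (cs.simple j * (r ^ k * p.1 * (r ^ k)⁻¹) * cs.simple j = cs.simple i) ↔
        p.1 = cs.simple j * r ^ (2 * k + 1) := by
      have h2 : cs.simple j * r ^ (2 * k + 1)
          = (r ^ k)⁻¹ * (cs.simple j * cs.simple i * cs.simple j) * r ^ k := by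
        rw [show 2 * k + 1 = k + (1 + k) by ring, pow_add, pow_add, ← mul_assoc, key, pow_one]
        generalize r ^ k = q
        rw [hr]
        simp only [mul_assoc]
      rw [h2]
      constructor
      · intro h; rw [← h]
        have : cs.simple j * (cs.simple j * (r ^ k * p.1 * (r ^ k)⁻¹) * cs.simple j) * cs.simple j
          = (cs.simple j * cs.simple j) * (r ^ k * p.1 * (r ^ k)⁻¹) * (cs.simple j * cs.simple j) := by
          group
        rw [this, hj]; group
      · intro h; rw [h]
        have : cs.simple j * (r ^ k * ((r ^ k)⁻¹ * (cs.simple j * cs.simple i * cs.simple j) * r ^ k)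
            * (r ^ k)⁻¹) * cs.simple j
          = (cs.simple j * cs.simple j) * cs.simple i * (cs.simple j * cs.simple j) := by group
        rw [this, hj]; group
    simp only [e1, e2]
    refine Prod.ext ?_ ?_
    · simp only
      rw [pow_succ', mul_inv_rev, hrinv, hr]; group
    · simp only
      rw [show 2 * (k + 1) = 2 * k + 1 + 1 by ring, Finset.sum_range_succ, Finset.sum_range_succ]
      ring

theorem signOp_liftable : M.IsLiftable (signOp cs) := by
  classical
  intro i j
  funext p
  rw [signOp_pow, cs.simple_mul_simple_pow]
  refine Prod.ext (by simp [end_one_apply]) ?_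
  simp only [end_one_apply]
  have : ∀ m, (cs.simple i * cs.simple j) ^ (M i j + m) = (cs.simple i * cs.simple j) ^ m := by
    intro m; rw [pow_add, cs.simple_mul_simple_pow, one_mul]
  rw [two_mul, Finset.sum_range_add]
  simp only [this]
  rw [CharTwo.add_self_eq_zero, add_zero]

noncomputable def signHom : W →* Function.End (W × ZMod 2) := cs.lift ⟨signOp cs, signOp_liftable cs⟩

open Classical in
theorem signHom_wordProd (ω : List B) (p : W × ZMod 2) :
    signHom cs (cs.wordProd ω) p =
      (cs.wordProd ω * p.1 * (cs.wordProd ω)⁻¹, p.2 + ((cs.rightInvSeq ω).count p.1 : ZMod 2)) := by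
  induction ω with
  | nil => simp [end_one_apply]
  | cons i ω ih =>
    rw [cs.wordProd_cons, map_mul, end_mul_apply, ih, signHom,
      cs.lift_apply_simple]
    simp only [signOp, CoxeterSystem.rightInvSeq, List.count_cons, mul_inv_rev, cs.inv_simple]
    have : (cs.wordProd ω * p.1 * (cs.wordProd ω)⁻¹ = cs.simple i) ↔
      ((cs.wordProd ω)⁻¹ * cs.simple i * cs.wordProd ω = p.1) := by
      constructor
      · intro h; rw [← h]; group
      · intro h; rw [← h]; group
    refine Prod.ext (by simp only; group) ?_
    simp only [this, beq_iff_eq]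
    push_cast
    ring

/-- The exchange condition: a right descent of `w` occurs in the right inversion sequence of
every word for `w`. -/
theorem mem_rightInvSeq {ω : List B} {i : B}
    (h : cs.length (cs.wordProd ω * cs.simple i) < cs.length (cs.wordProd ω)) :
    cs.simple i ∈ cs.rightInvSeq ω := by
  classical
  by_contra hn
  obtain ⟨ω', hω', he⟩ := cs.exists_isReduced (cs.wordProd ω * cs.simple i)
  have h1 := signHom_wordProd cs ω' (cs.simple i, 0)
  rw [← he, map_mul, end_mul_apply, signHom, cs.lift_apply_simple] at h1
  have h2 := signHom_wordProd cs ω (cs.simple i, 1)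
  rw [List.count_eq_zero_of_not_mem hn] at h2
  simp only [signOp, cs.simple_mul_simple_self, one_mul, if_true, zero_add] at h1
  rw [← signHom, h2] at h1
  have h3 := congrArg Prod.snd h1
  simp only [Nat.cast_zero, add_zero] at h3
  have h4 : cs.simple i ∈ cs.rightInvSeq ω' := by
    by_contra h5
    rw [List.count_eq_zero_of_not_mem h5] at h3
    simp at h3
  have h6 := (cs.isRightInversion_of_mem_rightInvSeq hω' h4).2
  rw [← he] at h6
  simp only [mul_assoc, cs.simple_mul_simple_self, mul_one] at h6
  omega

theorem simple_mul_eq_mul_simple_of_lt {w : W} {i j : B}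
    (h1 : cs.length w < cs.length (cs.simple i * w)) (h2 : cs.length w < cs.length (w * cs.simple j))
    (h3 : cs.length (cs.simple i * w * cs.simple j) < cs.length (cs.simple i * w)) :
    cs.simple i * w = w * cs.simple j := by
  obtain ⟨ω, hω, rfl⟩ := cs.exists_isReduced w
  rw [← cs.wordProd_cons] at h3
  have h4 := mem_rightInvSeq cs h3
  rw [CoxeterSystem.rightInvSeq, List.mem_cons] at h4
  rcases h4 with h4 | h4
  · rw [h4]; group
  · have := (cs.isRightInversion_of_mem_rightInvSeq hω h4).2
    omega

end Exchange

section Hecke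

variable {B W Γ : Type*} [Group W] {M : CoxeterMatrix B} [AddCommGroup Γ]

/-- A map from the set of `W`-conjugacy classes of simple reflections to `Γ`, given as a function on
the (indices of the) simple reflections which is constant on conjugacy classes. -/
structure WeightMap (cs : CoxeterSystem M W) (Γ : Type*) where
  toFun : B → Γ
  conj_eq : ∀ i j, IsConj (cs.simple i) (cs.simple j) → toFun i = toFun j

/-- The group ring `ℤ[Γ]`. -/
abbrev GroupRing (Γ : Type*) [AddCommGroup Γ] : Type _ := AddMonoidAlgebra ℤ Γ

/-- The basis element `e^γ` of `ℤ[Γ]`. -/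
noncomputable def expo (γ : Γ) : GroupRing Γ := AddMonoidAlgebra.single γ 1

theorem expo_mul (γ δ : Γ) : expo γ * expo δ = expo (γ + δ) := by
  simp [expo, AddMonoidAlgebra.single_mul_single]

theorem expo_zero : expo (0 : Γ) = 1 := rfl

/-- The Hecke algebra `H(W, S, φ)`: the free `ℤ[Γ]`-module with basis indexed by `W`.
Its multiplication is constructed below. -/
def Hecke (cs : CoxeterSystem M W) (_φ : WeightMap cs Γ) : Type _ := W →₀ GroupRing Γ

namespace Hecke

variable (cs : CoxeterSystem M W) (φ : WeightMap cs Γ)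

noncomputable instance : AddCommGroup (Hecke cs φ) :=
  inferInstanceAs (AddCommGroup (W →₀ GroupRing Γ))

noncomputable instance : Module (GroupRing Γ) (Hecke cs φ) :=
  inferInstanceAs (Module (GroupRing Γ) (W →₀ GroupRing Γ))

/-- The basis `(T_w)` of the Hecke algebra. -/
noncomputable def basis : Module.Basis W (GroupRing Γ) (Hecke cs φ) :=
  Module.Basis.ofRepr (LinearEquiv.refl (GroupRing Γ) (W →₀ GroupRing Γ))

/-- The standard basis element `T_w`. -/
noncomputable def T (w : W) : Hecke cs φ := basis cs φ w

/-- The scalar `e^{φ(s)} - e^{-φ(s)}`. -/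
noncomputable def xi (i : B) : GroupRing Γ := expo (φ.toFun i) - expo (-φ.toFun i)

open Classical in
/-- Left multiplication by `T_s` for a simple reflection `s`. -/
noncomputable def leftOp (i : B) : Hecke cs φ →ₗ[GroupRing Γ] Hecke cs φ :=
  (basis cs φ).constr (GroupRing Γ) fun w =>
    if cs.length w < cs.length (cs.simple i * w) then T cs φ (cs.simple i * w)
    else T cs φ (cs.simple i * w) + xi cs φ i • T cs φ w

open Classical in
/-- Right multiplication by `T_s` for a simple reflection `s`. -/
noncomputable def rightOp (i : B) : Hecke cs φ →ₗ[GroupRing Γ] Hecke cs φ :=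
  (basis cs φ).constr (GroupRing Γ) fun w =>
    if cs.length w < cs.length (w * cs.simple i) then T cs φ (w * cs.simple i)
    else T cs φ (w * cs.simple i) + xi cs φ i • T cs φ w

/-- A chosen reduced word of `w`. -/
noncomputable def reducedWord (w : W) : List B := (cs.exists_isReduced w).choose

/-- Left multiplication by an element `h`; for `h = T_w` it is the composite of the operators
`leftOp` along a reduced word of `w`. -/
noncomputable def leftMul : Hecke cs φ →ₗ[GroupRing Γ] Module.End (GroupRing Γ) (Hecke cs φ) :=
  (basis cs φ).constr (GroupRing Γ) fun w => ((reducedWord cs w).map (leftOp cs φ)).prod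

theorem leftOp_up {i : B} {w : W} (h : cs.length w < cs.length (cs.simple i * w)) :
    leftOp cs φ i (T cs φ w) = T cs φ (cs.simple i * w) := by
  rw [leftOp, T, Module.Basis.constr_basis, if_pos h]

theorem leftOp_down {i : B} {w : W} (h : cs.length (cs.simple i * w) < cs.length w) :
    leftOp cs φ i (T cs φ w) = T cs φ (cs.simple i * w) + xi cs φ i • T cs φ w := by
  rw [leftOp, T, Module.Basis.constr_basis, if_neg h.not_gt]; rfl

theorem rightOp_up {i : B} {w : W} (h : cs.length w < cs.length (w * cs.simple i)) :
    rightOp cs φ i (T cs φ w) = T cs φ (w * cs.simple i) := by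
  rw [rightOp, T, Module.Basis.constr_basis, if_pos h]

theorem rightOp_down {i : B} {w : W} (h : cs.length (w * cs.simple i) < cs.length w) :
    rightOp cs φ i (T cs φ w) = T cs φ (w * cs.simple i) + xi cs φ i • T cs φ w := by
  rw [rightOp, T, Module.Basis.constr_basis, if_neg h.not_gt]; rfl

theorem lt_or_gt_left (i : B) (w : W) : cs.length w < cs.length (cs.simple i * w) ∨
    cs.length (cs.simple i * w) < cs.length w := by
  rcases cs.length_simple_mul w i with h | h <;> omega

theorem lt_or_gt_right (i : B) (w : W) : cs.length w < cs.length (w * cs.simple i) ∨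
    cs.length (w * cs.simple i) < cs.length w := by
  rcases cs.length_mul_simple w i with h | h <;> omega

theorem xi_eq {i j : B} {w : W} (h : cs.simple i * w = w * cs.simple j) :
    xi cs φ i = xi cs φ j := by
  have : IsConj (cs.simple j) (cs.simple i) := by
    rw [isConj_iff]; exact ⟨w, by rw [← h]; group⟩
  rw [xi, xi, φ.conj_eq j i this]

theorem leftOp_rightOp (i j : B) (h : Hecke cs φ) :
    leftOp cs φ i (rightOp cs φ j h) = rightOp cs φ j (leftOp cs φ i h) := by
  have : (leftOp cs φ i) ∘ₗ (rightOp cs φ j) = (rightOp cs φ j) ∘ₗ (leftOp cs φ i) := by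
    refine (basis cs φ).ext fun w => ?_
    change leftOp cs φ i (rightOp cs φ j (T cs φ w)) = rightOp cs φ j (leftOp cs φ i (T cs φ w))
    have hA := cs.length_simple_mul w i
    have hB := cs.length_mul_simple w j
    have hC := cs.length_mul_simple (cs.simple i * w) j
    have hD := cs.length_simple_mul (w * cs.simple j) i
    rw [← mul_assoc] at hD
    have ii : cs.simple i * (cs.simple i * w) = w := by simp
    have jj : w * cs.simple j * cs.simple j = w := by simp
    rcases lt_or_gt_left cs i w with h1 | h1 <;> rcases lt_or_gt_right cs j w with h2 | h2
    · rw [rightOp_up cs φ h2, leftOp_up cs φ h1]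
      rcases lt_or_gt_right cs j (cs.simple i * w) with h3 | h3
      · rw [rightOp_up cs φ h3, leftOp_up cs φ (by rw [← mul_assoc]; omega), mul_assoc]
      · have he := simple_mul_eq_mul_simple_of_lt cs h1 h2 h3
        rw [rightOp_down cs φ h3, leftOp_down cs φ (by rw [← mul_assoc]; omega), mul_assoc,
          xi_eq cs φ he, he]
    · rw [rightOp_down cs φ h2, leftOp_up cs φ h1, map_add, map_smul, leftOp_up cs φ h1,
        leftOp_up cs φ (by rw [← mul_assoc]; omega), rightOp_down cs φ (by omega), mul_assoc]
    · rw [rightOp_up cs φ h2, leftOp_down cs φ h1, map_add, map_smul, rightOp_up cs φ h2,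
        leftOp_down cs φ (by rw [← mul_assoc]; omega), rightOp_up cs φ (by omega), mul_assoc]
    · rw [rightOp_down cs φ h2, leftOp_down cs φ h1, map_add, map_smul, map_add, map_smul,
        rightOp_down cs φ h2, leftOp_down cs φ h1]
      rcases lt_or_gt_right cs j (cs.simple i * w) with h3 | h3
      · have he : cs.simple i * (cs.simple i * w) = (cs.simple i * w) * cs.simple j := by
          refine simple_mul_eq_mul_simple_of_lt cs (by rw [ii]; omega) h3 ?_
          rw [ii]; omega
        have he' : cs.simple i * w = w * cs.simple j := by
          rw [ii] at he
          nth_rw 2 [he]; simp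
        rw [rightOp_up cs φ h3, leftOp_up cs φ (by rw [← mul_assoc]; omega), mul_assoc,
          xi_eq cs φ he', he']
      · rw [rightOp_down cs φ h3, leftOp_down cs φ (by rw [← mul_assoc]; omega), mul_assoc]
        module
  exact LinearMap.congr_fun this h

/-- An endomorphism commuting with all right multiplications is determined by its value at `1`. -/
theorem ext_of_commute {f g : Module.End (GroupRing Γ) (Hecke cs φ)}
    (hf : ∀ i h, f (rightOp cs φ i h) = rightOp cs φ i (f h))
    (hg : ∀ i h, g (rightOp cs φ i h) = rightOp cs φ i (g h))
    (h1 : f (T cs φ 1) = g (T cs φ 1)) : f = g := by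
  refine (basis cs φ).ext fun w => ?_
  change f (T cs φ w) = g (T cs φ w)
  induction hn : cs.length w using Nat.strong_induction_on generalizing w with
  | _ n ih =>
    by_cases hw : w = 1
    · rw [hw, h1]
    · obtain ⟨i, hi⟩ := cs.exists_rightDescent_of_ne_one hw
      have hi' : cs.length (w * cs.simple i) < cs.length w := hi
      have := rightOp_up cs φ (i := i) (w := w * cs.simple i) (by simpa using hi')
      rw [mul_assoc, cs.simple_mul_simple_self, mul_one] at this
      rw [← this, hf, hg, ih _ (by omega) _ rfl]

theorem leftWord_commute (ω : List B) (i : B) (h : Hecke cs φ) :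
    (ω.map (leftOp cs φ)).prod (rightOp cs φ i h) =
      rightOp cs φ i ((ω.map (leftOp cs φ)).prod h) := by
  induction ω with
  | nil => rfl
  | cons j ω ih =>
    rw [List.map_cons, List.prod_cons, Module.End.mul_apply, Module.End.mul_apply, ih,
      leftOp_rightOp]

theorem leftWord_one {ω : List B} (hω : cs.IsReduced ω) :
    (ω.map (leftOp cs φ)).prod (T cs φ 1) = T cs φ (cs.wordProd ω) := by
  induction ω with
  | nil => simp
  | cons j ω ih =>
    have h1 : cs.IsReduced ω := by simpa using hω.drop 1
    rw [List.map_cons, List.prod_cons, Module.End.mul_apply, ih h1, leftOp_up, cs.wordProd_cons]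
    rw [← cs.wordProd_cons, hω.eq, h1.eq]
    simp

theorem leftMul_T (w : W) :
    leftMul cs φ (T cs φ w) = ((reducedWord cs w).map (leftOp cs φ)).prod :=
  (basis cs φ).constr_basis _ _ w

theorem leftMul_commute (x : Hecke cs φ) (i : B) (h : Hecke cs φ) :
    leftMul cs φ x (rightOp cs φ i h) = rightOp cs φ i (leftMul cs φ x h) := by
  have : (leftMul cs φ).flip (rightOp cs φ i h) = rightOp cs φ i ∘ₗ (leftMul cs φ).flip h := by
    refine (basis cs φ).ext fun w => ?_
    change leftMul cs φ (T cs φ w) _ = rightOp cs φ i (leftMul cs φ (T cs φ w) h)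
    rw [leftMul_T, leftWord_commute]
  exact LinearMap.congr_fun this x

theorem leftMul_one (x : Hecke cs φ) : leftMul cs φ x (T cs φ 1) = x := by
  have : (leftMul cs φ).flip (T cs φ 1) = LinearMap.id := by
    refine (basis cs φ).ext fun w => ?_
    change leftMul cs φ (T cs φ w) (T cs φ 1) = T cs φ w
    have h := (cs.exists_isReduced w).choose_spec
    rw [leftMul_T, reducedWord, leftWord_one cs φ h.1, ← h.2]
  exact LinearMap.congr_fun this x

noncomputable instance : One (Hecke cs φ) := ⟨T cs φ 1⟩

noncomputable instance : Mul (Hecke cs φ) := ⟨fun x y => leftMul cs φ x y⟩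

theorem one_def : (1 : Hecke cs φ) = T cs φ 1 := rfl

theorem mul_def (x y : Hecke cs φ) : x * y = leftMul cs φ x y := rfl

theorem leftMul_mul (x y : Hecke cs φ) :
    leftMul cs φ (x * y) = leftMul cs φ x * leftMul cs φ y := by
  refine ext_of_commute cs φ (fun i h => leftMul_commute cs φ _ i h) (fun i h => ?_) ?_
  · rw [Module.End.mul_apply, leftMul_commute, leftMul_commute, Module.End.mul_apply]
  · rw [leftMul_one, Module.End.mul_apply, leftMul_one, mul_def]

noncomputable instance : Ring (Hecke cs φ) where
  left_distrib x y z := map_add (leftMul cs φ x) y z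
  right_distrib x y z := by simp only [mul_def, map_add, LinearMap.add_apply]
  zero_mul x := by simp only [mul_def, map_zero, LinearMap.zero_apply]
  mul_zero x := map_zero (leftMul cs φ x)
  mul_assoc x y z := by rw [mul_def cs φ (x * y), leftMul_mul]; rfl
  one_mul x := by
    have : leftMul cs φ (T cs φ 1) = 1 :=
      ext_of_commute cs φ (leftMul_commute cs φ _) (fun _ _ => rfl) (leftMul_one cs φ _)
    rw [mul_def, one_def, this, Module.End.one_apply]
  mul_one x := leftMul_one cs φ x
  neg_add_cancel := neg_add_cancel
  zsmul := (inferInstance : AddCommGroup (Hecke cs φ)).zsmul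
  zsmul_zero' := (inferInstance : AddCommGroup (Hecke cs φ)).zsmul_zero'
  zsmul_succ' := (inferInstance : AddCommGroup (Hecke cs φ)).zsmul_succ'
  zsmul_neg' := (inferInstance : AddCommGroup (Hecke cs φ)).zsmul_neg'
  nsmul := (inferInstance : AddCommGroup (Hecke cs φ)).nsmul
  nsmul_zero := (inferInstance : AddCommGroup (Hecke cs φ)).nsmul_zero
  nsmul_succ := (inferInstance : AddCommGroup (Hecke cs φ)).nsmul_succ
  sub_eq_add_neg := sub_eq_add_neg

noncomputable instance : Algebra (GroupRing Γ) (Hecke cs φ) :=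
  Algebra.ofModule
    (fun a x y => by simp only [mul_def, map_smul, LinearMap.smul_apply])
    (fun a x y => map_smul (leftMul cs φ x) a y)

theorem leftMul_simple (i : B) : leftMul cs φ (T cs φ (cs.simple i)) = leftOp cs φ i := by
  refine ext_of_commute cs φ (leftMul_commute cs φ _) (leftOp_rightOp cs φ i) ?_
  rw [leftMul_one, leftOp_up, mul_one]
  simp

theorem T_simple_mul (i : B) (h : Hecke cs φ) : T cs φ (cs.simple i) * h = leftOp cs φ i h := by
  rw [mul_def, leftMul_simple]

/-- `T_v T_w = T_{vw}` if the lengths add. -/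
theorem T_mul_T {v w : W} (h : cs.length (v * w) = cs.length v + cs.length w) :
    T cs φ v * T cs φ w = T cs φ (v * w) := by
  induction hn : cs.length v using Nat.strong_induction_on generalizing v with
  | _ n ih =>
    by_cases hv : v = 1
    · rw [hv, ← one_def, one_mul, one_mul]
    · obtain ⟨i, hi⟩ := cs.exists_leftDescent_of_ne_one hv
      have hi' : cs.length (cs.simple i * v) + 1 = cs.length v :=
        (cs.isLeftDescent_iff).1 hi
      have h1 := cs.length_simple_mul (v * w) i
      have h2 := cs.length_mul_le (cs.simple i * v) w
      rw [mul_assoc] at h2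
      have h3 := leftOp_up cs φ (i := i) (w := cs.simple i * v) (by simp; omega)
      have h4 := leftOp_up cs φ (i := i) (w := cs.simple i * v * w) (by simp [mul_assoc]; omega)
      simp only [mul_assoc, cs.simple_mul_simple_cancel_left] at h3 h4
      rw [← h3, ← T_simple_mul, mul_assoc, ih _ (by omega) (by rw [mul_assoc]; omega) rfl,
        T_simple_mul, mul_assoc, h4]

theorem T_simple_sq (i : B) :
    T cs φ (cs.simple i) * T cs φ (cs.simple i) = 1 + xi cs φ i • T cs φ (cs.simple i) := by
  rw [T_simple_mul, leftOp_down, cs.simple_mul_simple_self, one_def]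
  simp

/-- The quadratic relation `(T_s - e^{φ(s)}) (T_s + e^{-φ(s)}) = 0`. -/
theorem T_quadratic (i : B) :
    (T cs φ (cs.simple i) - algebraMap (GroupRing Γ) _ (expo (φ.toFun i))) *
      (T cs φ (cs.simple i) + algebraMap (GroupRing Γ) _ (expo (-φ.toFun i))) = 0 := by
  rw [Algebra.algebraMap_eq_smul_one, Algebra.algebraMap_eq_smul_one, sub_mul, mul_add, mul_add,
    T_simple_sq, mul_smul_comm, mul_one, smul_mul_assoc, one_mul, smul_mul_smul_comm, expo_mul,
    add_neg_cancel, expo_zero, one_mul, one_smul, xi]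
  module

theorem T_simple_mul_sub (i : B) :
    T cs φ (cs.simple i) * (T cs φ (cs.simple i) - xi cs φ i • 1) = 1 := by
  rw [mul_sub, T_simple_sq, mul_smul_comm, mul_one]; abel

theorem sub_mul_T_simple (i : B) :
    (T cs φ (cs.simple i) - xi cs φ i • 1) * T cs φ (cs.simple i) = 1 := by
  rw [sub_mul, T_simple_sq, smul_mul_assoc, one_mul]; abel

theorem isUnit_T_simple (i : B) : IsUnit (T cs φ (cs.simple i)) :=
  ⟨⟨_, _, T_simple_mul_sub cs φ i, sub_mul_T_simple cs φ i⟩, rfl⟩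

theorem exists_left_factor {w : W} (hw : w ≠ 1) : ∃ i v, w = cs.simple i * v ∧
    cs.length w = cs.length v + 1 ∧ T cs φ w = T cs φ (cs.simple i) * T cs φ v := by
  obtain ⟨i, hi⟩ := cs.exists_leftDescent_of_ne_one hw
  have hi' : cs.length (cs.simple i * w) + 1 = cs.length w := (cs.isLeftDescent_iff).1 hi
  refine ⟨i, cs.simple i * w, by simp, hi'.symm, ?_⟩
  rw [T_mul_T] <;> simp
  omega

/-- Each `T_w` is invertible. -/
theorem isUnit_T (w : W) : IsUnit (T cs φ w) := by
  induction hn : cs.length w using Nat.strong_induction_on generalizing w with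
  | _ n ih =>
    by_cases hw : w = 1
    · rw [hw, ← one_def]; exact isUnit_one
    · obtain ⟨i, v, -, h2, h3⟩ := exists_left_factor cs φ hw
      rw [h3]
      exact (isUnit_T_simple cs φ i).mul (ih _ (by omega) v rfl)


/-! ### The bar involution -/

/-- The involution `e^γ ↦ e^{-γ}` of `ℤ[Γ]`. -/
noncomputable def barScalar : GroupRing Γ →+* GroupRing Γ :=
  AddMonoidAlgebra.mapDomainRingHom ℤ (negAddMonoidHom : Γ →+ Γ)

theorem barScalar_expo (γ : Γ) : barScalar (expo γ) = expo (-γ) := by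
  simp [barScalar, expo]

theorem barScalar_coeff (a : GroupRing Γ) (γ : Γ) : (barScalar a).coeff γ = a.coeff (-γ) := by
  have := Finsupp.mapDomain_apply (f := fun x : Γ => -x) neg_injective a.coeff (-γ)
  simp only [neg_neg] at this
  rw [← this]
  rfl

theorem barScalar_barScalar (a : GroupRing Γ) : barScalar (barScalar a) = a := by
  ext γ
  rw [barScalar_coeff, barScalar_coeff, neg_neg]

theorem barScalar_xi (i : B) : barScalar (xi cs φ i) = - xi cs φ i := by
  rw [xi, map_sub, barScalar_expo, barScalar_expo, neg_neg, neg_sub]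

/-- The antilinear map `h ↦ h̄` with `T_w ↦ (T_{w⁻¹})⁻¹`. -/
noncomputable def bar : Hecke cs φ →ₛₗ[barScalar (Γ := Γ)] Hecke cs φ where
  toFun h := ((basis cs φ).repr h).sum fun w a => barScalar a • Ring.inverse (T cs φ w⁻¹)
  map_add' x y := by
    rw [map_add, Finsupp.sum_add_index']
    · simp
    · intro w a b; rw [map_add, add_smul]
  map_smul' a x := by
    rw [map_smul, Finsupp.sum_smul_index]
    · rw [Finsupp.smul_sum]
      simp only [map_mul, mul_smul]
    · simp

theorem bar_apply (h : Hecke cs φ) : bar cs φ h =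
    ((basis cs φ).repr h).sum fun w a => barScalar a • Ring.inverse (T cs φ w⁻¹) := rfl

theorem bar_T (w : W) : bar cs φ (T cs φ w) = Ring.inverse (T cs φ w⁻¹) := by
  rw [bar_apply, T, Module.Basis.repr_self, Finsupp.sum_single_index] <;> simp

theorem induction_T {p : Hecke cs φ → Prop} (h : Hecke cs φ) (hT : ∀ w, p (T cs φ w))
    (h0 : p 0) (hadd : ∀ x y, p x → p y → p (x + y)) (hsmul : ∀ (a : GroupRing Γ) x, p x → p (a • x)) :
    p h := by
  rw [← (basis cs φ).linearCombination_repr h, Finsupp.linearCombination_apply, Finsupp.sum]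
  exact Finset.sum_induction _ p hadd h0 fun w _ => hsmul _ _ (hT w)

theorem inverse_T_simple (i : B) :
    Ring.inverse (T cs φ (cs.simple i)) = T cs φ (cs.simple i) - xi cs φ i • 1 :=
  Ring.inverse_unit ⟨_, _, T_simple_mul_sub cs φ i, sub_mul_T_simple cs φ i⟩

theorem bar_T_simple (i : B) :
    bar cs φ (T cs φ (cs.simple i)) = T cs φ (cs.simple i) - xi cs φ i • 1 := by
  rw [bar_T, cs.inv_simple, inverse_T_simple]

theorem bar_one : bar cs φ 1 = 1 := by
  rw [one_def, bar_T, inv_one, ← one_def, Ring.inverse_one]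

theorem ring_inverse_mul {R : Type*} [Ring R] {a b : R} (ha : IsUnit a) (hb : IsUnit b) :
    Ring.inverse (a * b) = Ring.inverse b * Ring.inverse a := by
  obtain ⟨u, rfl⟩ := ha
  obtain ⟨v, rfl⟩ := hb
  rw [← Units.val_mul, Ring.inverse_unit, Ring.inverse_unit, Ring.inverse_unit, mul_inv_rev,
    Units.val_mul]

theorem bar_T_mul_T {v w : W} (h : cs.length (v * w) = cs.length v + cs.length w) :
    bar cs φ (T cs φ (v * w)) = bar cs φ (T cs φ v) * bar cs φ (T cs φ w) := by
  rw [bar_T, bar_T, bar_T, mul_inv_rev, ← T_mul_T, ring_inverse_mul (isUnit_T _ _ _) (isUnit_T _ _ _)]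
  rw [← mul_inv_rev, cs.length_inv, cs.length_inv, cs.length_inv, h, add_comm]

theorem bar_simple_mul (i : B) (h : Hecke cs φ) :
    bar cs φ (T cs φ (cs.simple i) * h) = bar cs φ (T cs φ (cs.simple i)) * bar cs φ h := by
  induction h using induction_T with
  | h0 => simp
  | hadd x y hx hy => rw [mul_add, map_add, hx, hy, map_add, mul_add]
  | hsmul a x hx => rw [mul_smul_comm, map_smulₛₗ, hx, map_smulₛₗ, mul_smul_comm]
  | hT w =>
    rcases lt_or_gt_left cs i w with h | h
    · have h' : cs.length (cs.simple i * w) = cs.length (cs.simple i) + cs.length w := by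
        have := cs.length_simple_mul w i
        rw [cs.length_simple]; omega
      rw [T_mul_T cs φ h', bar_T_mul_T cs φ h']
    · obtain ⟨v, rfl⟩ : ∃ v, w = cs.simple i * v := ⟨cs.simple i * w, by simp⟩
      rw [cs.simple_mul_simple_cancel_left] at h
      have h' : cs.length (cs.simple i * v) = cs.length (cs.simple i) + cs.length v := by
        have := cs.length_simple_mul v i
        rw [cs.length_simple]; omega
      rw [bar_T_mul_T cs φ h', ← T_mul_T cs φ h', ← mul_assoc, T_simple_sq, add_mul, one_mul,
        smul_mul_assoc, T_mul_T cs φ h', map_add, map_smulₛₗ, bar_T_mul_T cs φ h', barScalar_xi,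
        ← mul_assoc, bar_T_simple]
      have : (T cs φ (cs.simple i) - xi cs φ i • 1) * (T cs φ (cs.simple i) - xi cs φ i • 1) =
          1 - xi cs φ i • (T cs φ (cs.simple i) - xi cs φ i • 1) := by
        rw [sub_mul (T cs φ (cs.simple i)), T_simple_mul_sub, smul_mul_assoc, one_mul]
      rw [this, sub_mul 1, one_mul, smul_mul_assoc, neg_smul, ← sub_eq_add_neg]

/-- The bar involution is multiplicative. -/
theorem bar_mul (x y : Hecke cs φ) : bar cs φ (x * y) = bar cs φ x * bar cs φ y := by
  induction x using induction_T with
  | h0 => simp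
  | hadd x z hx hz => rw [add_mul, map_add, hx, hz, map_add, add_mul]
  | hsmul a x hx => rw [smul_mul_assoc, map_smulₛₗ, hx, map_smulₛₗ, smul_mul_assoc]
  | hT w =>
    induction hn : cs.length w using Nat.strong_induction_on generalizing w with
    | _ n ih =>
      by_cases hw : w = 1
      · rw [hw, ← one_def, one_mul, bar_one, one_mul]
      · obtain ⟨i, v, -, h2, h3⟩ := exists_left_factor cs φ hw
        rw [h3, mul_assoc, bar_simple_mul, ih _ (by omega) v rfl, bar_simple_mul, mul_assoc]

/-- The bar involution is an involution. -/
theorem bar_bar (x : Hecke cs φ) : bar cs φ (bar cs φ x) = x := by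
  induction x using induction_T with
  | h0 => simp
  | hadd x z hx hz => rw [map_add, map_add, hx, hz]
  | hsmul a x hx => rw [map_smulₛₗ, map_smulₛₗ, hx, barScalar_barScalar]
  | hT w =>
    have h1 : bar cs φ (bar cs φ (T cs φ w)) * bar cs φ (T cs φ w⁻¹) = 1 := by
      rw [← bar_mul, bar_T, Ring.inverse_mul_cancel _ (isUnit_T cs φ _), bar_one]
    rw [bar_T cs φ w⁻¹, inv_inv] at h1
    have h2 := Ring.inverse_mul_cancel _ (isUnit_T cs φ w)
    rw [← mul_one (bar cs φ _), ← h2, ← mul_assoc, h1, one_mul]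

/-! ### The Kazhdan-Lusztig basis -/

/-- The span of the `T_w` with `ℓ(w) < n`. -/
noncomputable def filt (n : ℕ) : Submodule (GroupRing Γ) (Hecke cs φ) :=
  (Finsupp.supported (GroupRing Γ) (GroupRing Γ) {w : W | cs.length w < n}).comap
    ((basis cs φ).repr : Hecke cs φ →ₗ[GroupRing Γ] (W →₀ GroupRing Γ))

/-- The coefficient of `T_w` in `h`. -/
noncomputable def coeff (h : Hecke cs φ) (w : W) : GroupRing Γ := (basis cs φ).repr h w

theorem coeff_T (v w : W) [Decidable (v = w)] :
    coeff cs φ (T cs φ v) w = if v = w then 1 else 0 := by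
  rw [coeff, T, Module.Basis.repr_self, Finsupp.single_apply]

theorem coeff_add (x y : Hecke cs φ) (w : W) :
    coeff cs φ (x + y) w = coeff cs φ x w + coeff cs φ y w := by simp [coeff]

theorem coeff_sub (x y : Hecke cs φ) (w : W) :
    coeff cs φ (x - y) w = coeff cs φ x w - coeff cs φ y w := by simp [coeff]

theorem coeff_neg (x : Hecke cs φ) (w : W) :
    coeff cs φ (-x) w = - coeff cs φ x w := by simp [coeff]

theorem coeff_ext {x y : Hecke cs φ} (h : ∀ w, coeff cs φ x w = coeff cs φ y w) : x = y :=
  (basis cs φ).repr.injective (Finsupp.ext h)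

theorem mem_filt {n : ℕ} {h : Hecke cs φ} :
    h ∈ filt cs φ n ↔ ∀ w, n ≤ cs.length w → coeff cs φ h w = 0 := by
  rw [filt, Submodule.mem_comap, Finsupp.mem_supported']
  simp [coeff]

theorem T_mem_filt {n : ℕ} {w : W} (h : cs.length w < n) : T cs φ w ∈ filt cs φ n := by
  classical
  rw [mem_filt]
  intro v hv
  rw [coeff_T, if_neg]
  rintro rfl
  omega

theorem filt_mono {m n : ℕ} (h : m ≤ n) : filt cs φ m ≤ filt cs φ n := by
  intro x hx
  rw [mem_filt] at hx ⊢
  exact fun w hw => hx w (h.trans hw)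

theorem sum_coeff (x : Hecke cs φ) :
    x = ∑ w ∈ ((basis cs φ).repr x).support, coeff cs φ x w • T cs φ w := by
  conv_lhs => rw [← (basis cs φ).linearCombination_repr x, Finsupp.linearCombination_apply]
  rfl

theorem exists_mem_filt (x : Hecke cs φ) : ∃ n, x ∈ filt cs φ n := by
  refine ⟨((basis cs φ).repr x).support.sup cs.length + 1, ?_⟩
  nth_rw 2 [sum_coeff cs φ x]
  refine Submodule.sum_mem _ fun w hw => Submodule.smul_mem _ _ (T_mem_filt cs φ ?_)
  have := Finset.le_sup (f := cs.length) hw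
  omega

theorem simple_mul_mem_filt (i : B) {n : ℕ} {x : Hecke cs φ} (hx : x ∈ filt cs φ n) :
    T cs φ (cs.simple i) * x ∈ filt cs φ (n + 1) := by
  rw [sum_coeff cs φ x, Finset.mul_sum]
  refine Submodule.sum_mem _ fun w hw => ?_
  rw [mul_smul_comm]
  refine Submodule.smul_mem _ _ ?_
  have hw' : cs.length w < n := by
    by_contra h
    exact (Finsupp.mem_support_iff.1 hw) ((mem_filt cs φ).1 hx w (by omega))
  have hl := cs.length_simple_mul w i
  rw [T_simple_mul]
  rcases lt_or_gt_left cs i w with h | h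
  · rw [leftOp_up cs φ h]; exact T_mem_filt cs φ (by omega)
  · rw [leftOp_down cs φ h]
    exact Submodule.add_mem _ (T_mem_filt cs φ (by omega))
      (Submodule.smul_mem _ _ (T_mem_filt cs φ (by omega)))

theorem bar_T_sub_mem (w : W) : bar cs φ (T cs φ w) - T cs φ w ∈ filt cs φ (cs.length w) := by
  induction hn : cs.length w using Nat.strong_induction_on generalizing w with
  | _ n ih =>
    by_cases hw : w = 1
    · rw [hw, ← one_def, bar_one, sub_self]; exact Submodule.zero_mem _
    · obtain ⟨i, v, -, h2, h3⟩ := exists_left_factor cs φ hw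
      obtain ⟨r, hr, hr'⟩ : ∃ r ∈ filt cs φ (cs.length v), bar cs φ (T cs φ v) = T cs φ v + r :=
        ⟨_, ih _ (by omega) v rfl, by abel⟩
      have : bar cs φ (T cs φ w) - T cs φ w =
          T cs φ (cs.simple i) * r - xi cs φ i • (T cs φ v + r) := by
        rw [h3, bar_mul, hr', bar_T_simple, sub_mul, mul_add, smul_mul_assoc, one_mul]
        abel
      rw [this, ← hn, h2]
      exact Submodule.sub_mem _ (simple_mul_mem_filt cs φ i hr) (Submodule.smul_mem _ _
        (Submodule.add_mem _ (T_mem_filt cs φ (by omega)) (filt_mono cs φ (by omega) hr)))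

theorem coeff_bar {n : ℕ} {x : Hecke cs φ} (hx : x ∈ filt cs φ (n + 1)) {w : W}
    (hw : cs.length w = n) : coeff cs φ (bar cs φ x) w = barScalar (coeff cs φ x w) := by
  classical
  have h1 : bar cs φ x - ∑ w ∈ ((basis cs φ).repr x).support,
      barScalar (coeff cs φ x w) • T cs φ w ∈ filt cs φ n := by
    nth_rw 1 [sum_coeff cs φ x]
    rw [map_sum, ← Finset.sum_sub_distrib]
    refine Submodule.sum_mem _ fun v hv => ?_
    have hv' : cs.length v ≤ n := by
      by_contra h
      exact (Finsupp.mem_support_iff.1 hv) ((mem_filt cs φ).1 hx v (by omega))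
    rw [map_smulₛₗ, ← smul_sub]
    exact Submodule.smul_mem _ _ (filt_mono cs φ hv' (bar_T_sub_mem cs φ v))
  have h2 := (mem_filt cs φ).1 h1 w hw.ge
  rw [coeff_sub, sub_eq_zero] at h2
  rw [h2, coeff, map_sum, Finsupp.finsetSum_apply]
  simp only [map_smul, Finsupp.smul_apply, T, Module.Basis.repr_self, Finsupp.single_apply,
    smul_eq_mul, mul_ite, mul_one, mul_zero]
  rw [Finset.sum_ite_eq']
  split_ifs with h
  · rfl
  · rw [coeff, Finsupp.notMem_support_iff.1 h, map_zero]

section Order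

variable [LinearOrder Γ]

/-- `a ∈ ℤ[Γ_{<0}]`. -/
def IsNeg (a : GroupRing Γ) : Prop := ∀ γ, a.coeff γ ≠ 0 → γ < 0

/-- `h ∈ H_{<0}`, that is, all coefficients of `h` are in `ℤ[Γ_{<0}]`. -/
def IsNegative (h : Hecke cs φ) : Prop := ∀ w, IsNeg (coeff cs φ h w)

/-- The defining property of the Kazhdan-Lusztig element `C_w`. -/
def IsKL (w : W) (c : Hecke cs φ) : Prop := bar cs φ c = c ∧ IsNegative cs φ (c - T cs φ w)

/-- The part of `a` supported on `Γ_{<0}`. -/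
noncomputable def negPart (a : GroupRing Γ) : GroupRing Γ :=
  AddMonoidAlgebra.ofCoeff (a.coeff.filter (· < 0))

theorem negPart_coeff (a : GroupRing Γ) (γ : Γ) :
    (negPart a).coeff γ = if γ < 0 then a.coeff γ else 0 :=
  Finsupp.filter_apply _ _ _

theorem isNeg_negPart (a : GroupRing Γ) : IsNeg (negPart a) := by
  intro γ h
  by_contra hn
  rw [negPart_coeff, if_neg hn] at h
  exact h rfl

theorem IsNeg.sub {a b : GroupRing Γ} (ha : IsNeg a) (hb : IsNeg b) : IsNeg (a - b) := by
  intro γ h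
  by_contra hn
  have h1 : a.coeff γ = 0 := by_contra fun h => hn (ha γ h)
  have h2 : b.coeff γ = 0 := by_contra fun h => hn (hb γ h)
  apply h
  simp [h1, h2]

variable [IsOrderedAddMonoid Γ]

theorem eq_negPart_sub {a : GroupRing Γ} (h : barScalar a = -a) :
    a - (negPart a - barScalar (negPart a)) = 0 := by
  ext γ
  have h1 : a.coeff (-γ) = - a.coeff γ := by rw [← barScalar_coeff, h]; simp
  simp only [AddMonoidAlgebra.coeff_sub, Finsupp.sub_apply, barScalar_coeff, negPart_coeff,
    Left.neg_neg_iff, AddMonoidAlgebra.coeff_zero, Finsupp.zero_apply]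
  rcases lt_trichotomy γ 0 with h2 | h2 | h2
  · simp [h2, h2.not_gt]
  · subst h2; simp at h1 ⊢; omega
  · simp [h2, h2.not_gt, h1]

theorem eq_zero_of_bar_eq {a : GroupRing Γ} (h : barScalar a = a) (hn : IsNeg a) : a = 0 := by
  ext γ
  by_contra h1
  have h2 := hn γ h1
  rw [← h, barScalar_coeff] at h1
  have h3 := hn _ h1
  rw [Left.neg_neg_iff] at h3
  exact lt_asymm h2 h3

theorem exists_sub_bar (n : ℕ) (h : Hecke cs φ) (hn : h ∈ filt cs φ n) (hb : bar cs φ h = -h) :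
    ∃ g, IsNegative cs φ g ∧ h = g - bar cs φ g := by
  induction n generalizing h with
  | zero =>
    have : h = 0 := coeff_ext cs φ fun w => by
      rw [(mem_filt cs φ).1 hn w (Nat.zero_le _)]; simp [coeff]
    refine ⟨0, ?_, by simp [this]⟩
    intro w γ h; simp [coeff] at h
  | succ n ih =>
    let b : Hecke cs φ := (basis cs φ).repr.symm
      (((basis cs φ).repr h).mapRange negPart (by ext γ; simp [negPart_coeff]))
    have hbc : ∀ w, coeff cs φ b w = negPart (coeff cs φ h w) := by
      intro w; simp [b, coeff]
    have hbn : b ∈ filt cs φ (n + 1) := by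
      rw [mem_filt] at hn ⊢
      intro w hw
      rw [hbc, hn w hw]
      ext γ; simp [negPart_coeff]
    have hbb : b - bar cs φ b ∈ filt cs φ (n + 1) := by
      rw [mem_filt]
      intro w hw
      rw [coeff_sub, (mem_filt cs φ).1 hbn w hw,
        coeff_bar cs φ (filt_mono cs φ (by omega) hbn) rfl, (mem_filt cs φ).1 hbn w hw]
      simp
    obtain ⟨g, hg, hg'⟩ := ih (h - (b - bar cs φ b)) (by
      rw [mem_filt]
      intro w hw
      rcases hw.eq_or_lt with hw | hw
      · have h1 := coeff_bar cs φ hn hw.symm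
        rw [hb, coeff_neg] at h1
        rw [coeff_sub, coeff_sub, coeff_bar cs φ hbn hw.symm, hbc, eq_negPart_sub h1.symm]
      · exact (mem_filt cs φ).1 (Submodule.sub_mem _ hn hbb) w hw) (by
      rw [map_sub, map_sub, bar_bar, hb]; abel)
    refine ⟨g + b, ?_, ?_⟩
    · intro w γ hw
      by_contra hγ
      have h1 : (coeff cs φ g w).coeff γ = 0 := by_contra fun h => hγ (hg w γ h)
      have h2 : (coeff cs φ b w).coeff γ = 0 := by
        rw [hbc]; exact by_contra fun h => hγ (isNeg_negPart _ γ h)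
      apply hw
      rw [coeff_add, AddMonoidAlgebra.coeff_add, Finsupp.add_apply, h1, h2, add_zero]
    · rw [map_add, sub_eq_iff_eq_add.1 hg']; abel

theorem eq_zero_of_isNegative (x : Hecke cs φ) (hx : IsNegative cs φ x) (hb : bar cs φ x = x) :
    x = 0 := by
  obtain ⟨n, hn⟩ := exists_mem_filt cs φ x
  induction n with
  | zero =>
    exact coeff_ext cs φ fun w => by
      rw [(mem_filt cs φ).1 hn w (Nat.zero_le _)]; simp [coeff]
  | succ n ih =>
    refine ih ((mem_filt cs φ).2 fun w hw => ?_)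
    rcases hw.eq_or_lt with hw | hw
    · have h1 := coeff_bar cs φ hn hw.symm
      rw [hb] at h1
      exact eq_zero_of_bar_eq h1.symm (hx w)
    · exact (mem_filt cs φ).1 hn w hw

/-- Existence and uniqueness of the Kazhdan-Lusztig element `C_w`. -/
theorem existsUnique_isKL (w : W) : ∃! c, IsKL cs φ w c := by
  obtain ⟨g, hg, hg'⟩ := exists_sub_bar cs φ _ _ (bar_T_sub_mem cs φ w)
    (by rw [map_sub, bar_bar, neg_sub])
  refine ⟨T cs φ w + g, ⟨?_, by simpa using hg⟩, ?_⟩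
  · rw [map_add, sub_eq_iff_eq_add.1 hg']; abel
  · rintro c ⟨hc, hc'⟩
    have hb : bar cs φ (T cs φ w + g) = T cs φ w + g := by
      rw [map_add, sub_eq_iff_eq_add.1 hg']; abel
    rw [← sub_eq_zero]
    refine eq_zero_of_isNegative cs φ _ (fun v => ?_) (by rw [map_sub, hc, hb])
    have : c - (T cs φ w + g) = (c - T cs φ w) - g := by abel
    rw [this, coeff_sub]
    exact (hc' v).sub (hg v)

/-- The Kazhdan-Lusztig element `C_w`: the unique element with `C̄_w = C_w` and
`C_w ≡ T_w mod H_{<0}`. -/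
noncomputable def C (w : W) : Hecke cs φ := (existsUnique_isKL cs φ w).choose

theorem isKL_C (w : W) : IsKL cs φ w (C cs φ w) := (existsUnique_isKL cs φ w).choose_spec.1

end Order


/-! ### Automorphisms of the Coxeter system act on the Hecke algebra -/

theorem length_le_of_perm (σ : W ≃* W) (hσ : ∀ i, ∃ j, σ (cs.simple i) = cs.simple j) (w : W) :
    cs.length (σ w) ≤ cs.length w := by
  obtain ⟨ω, hω, rfl⟩ := cs.exists_isReduced w
  rw [hω.eq]
  clear hω
  induction ω with
  | nil => simp
  | cons i ω ih =>
    obtain ⟨j, hj⟩ := hσ i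
    rw [cs.wordProd_cons, map_mul, hj, List.length_cons]
    have := cs.length_mul_le (cs.simple j) (σ (cs.wordProd ω))
    rw [cs.length_simple] at this
    omega

/-- The linear map `T_w ↦ T_{σ(w)}`. -/
noncomputable def permMap (σ : W ≃* W) : Hecke cs φ →ₗ[GroupRing Γ] Hecke cs φ :=
  (basis cs φ).constr (GroupRing Γ) fun w => T cs φ (σ w)

theorem permMap_T (σ : W ≃* W) (w : W) : permMap cs φ σ (T cs φ w) = T cs φ (σ w) := by
  rw [permMap, T, Module.Basis.constr_basis]

theorem permMap_mul (σ : W ≃* W)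
    (hσ : ∀ i, ∃ j, σ (cs.simple i) = cs.simple j ∧ φ.toFun i = φ.toFun j)
    (hσ' : ∀ i, ∃ j, σ.symm (cs.simple i) = cs.simple j) (x y : Hecke cs φ) :
    permMap cs φ σ (x * y) = permMap cs φ σ x * permMap cs φ σ y := by
  have hl : ∀ w, cs.length (σ w) = cs.length w := fun w => by
    refine le_antisymm (length_le_of_perm cs σ (fun i => (hσ i).imp fun _ h => h.1) w) ?_
    simpa using length_le_of_perm cs σ.symm hσ' (σ w)
  have hs : ∀ i y, permMap cs φ σ (T cs φ (cs.simple i) * y) =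
      permMap cs φ σ (T cs φ (cs.simple i)) * permMap cs φ σ y := by
    intro i y
    obtain ⟨j, hj, hij⟩ := hσ i
    induction y using induction_T with
    | h0 => simp
    | hadd x y hx hy => rw [mul_add, map_add, hx, hy, map_add, mul_add]
    | hsmul a x hx => rw [mul_smul_comm, map_smul, hx, map_smul, mul_smul_comm]
    | hT w =>
      rw [permMap_T, permMap_T, hj, T_simple_mul, T_simple_mul]
      have h1 : cs.length (cs.simple j * σ w) = cs.length (cs.simple i * w) := by
        rw [← hj, ← map_mul, hl]
      rcases lt_or_gt_left cs i w with h | h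
      · rw [leftOp_up cs φ h, leftOp_up cs φ (by rw [h1, hl]; exact h), permMap_T, map_mul, hj]
      · rw [leftOp_down cs φ h, leftOp_down cs φ (by rw [h1, hl]; exact h), map_add, map_smul,
          permMap_T, permMap_T, map_mul, hj, xi, xi, hij]
  induction x using induction_T with
  | h0 => simp
  | hadd x z hx hz => rw [add_mul, map_add, hx, hz, map_add, add_mul]
  | hsmul a x hx => rw [smul_mul_assoc, map_smul, hx, map_smul, smul_mul_assoc]
  | hT w =>
    induction hn : cs.length w using Nat.strong_induction_on generalizing w with
    | _ n ih =>
      by_cases hw : w = 1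
      · rw [hw, permMap_T, map_one, ← one_def, one_mul, one_mul]
      · obtain ⟨i, v, -, h2, h3⟩ := exists_left_factor cs φ hw
        rw [h3, mul_assoc, hs, ih _ (by omega) v rfl, hs, mul_assoc]

end Hecke
end Hecke

/-! ### The decomposition attached to a subset `I` of `S` -/

section Tilde

variable {B W Γ : Type*} [Group W] {M : CoxeterMatrix B} [AddCommGroup Γ]
variable (cs : CoxeterSystem M W) (I : Set B)

/-- No element of `I` is conjugate to an element of the complement `J` of `I`. -/
def NotConj : Prop := ∀ i ∈ I, ∀ j ∉ I, ¬ IsConj (cs.simple i) (cs.simple j)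

/-- The subgroup `W_I` generated by `I`. -/
def parabolic : Subgroup W := Subgroup.closure (cs.simple '' I)

/-- The set `J̃` of all `x t x⁻¹` with `x ∈ W_I` and `t ∈ J`. -/
def tildeSet : Set W := {t | ∃ x ∈ parabolic cs I, ∃ j ∉ I, t = x * cs.simple j * x⁻¹}

/-- The subgroup `W̃` generated by `J̃`. -/
def tildeGroup : Subgroup W := Subgroup.closure (tildeSet cs I)

theorem tildeSet_mul_self {t : W} (ht : t ∈ tildeSet cs I) : t * t = 1 := by
  obtain ⟨x, -, j, -, rfl⟩ := ht
  simp

theorem tildeSet_conj {x t : W} (hx : x ∈ parabolic cs I) (ht : t ∈ tildeSet cs I) :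
    x * t * x⁻¹ ∈ tildeSet cs I := by
  obtain ⟨y, hy, j, hj, rfl⟩ := ht
  exact ⟨x * y, mul_mem hx hy, j, hj, by group⟩

theorem tildeGroup_conj {x w : W} (hx : x ∈ parabolic cs I) (hw : w ∈ tildeGroup cs I) :
    x * w * x⁻¹ ∈ tildeGroup cs I := by
  induction hw using Subgroup.closure_induction with
  | mem t ht => exact Subgroup.subset_closure (tildeSet_conj cs I hx ht)
  | one => simp
  | mul a b _ _ ha hb =>
    have : x * (a * b) * x⁻¹ = (x * a * x⁻¹) * (x * b * x⁻¹) := by group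
    rw [this]; exact mul_mem ha hb
  | inv a _ ha =>
    have : x * a⁻¹ * x⁻¹ = (x * a * x⁻¹)⁻¹ := by group
    rw [this]; exact inv_mem ha

/-- The Coxeter matrix of `(W̃, J̃)`: the entry at `(t, t')` is the order of `t t'`
(`0` if it is infinite). -/
noncomputable def tildeMatrix : CoxeterMatrix (tildeSet cs I) where
  M t t' := orderOf (t.1 * t'.1)
  isSymm := by
    ext t t'
    change orderOf (t'.1 * t.1) = orderOf (t.1 * t'.1)
    have h : t'.1 * t.1 = (t.1 * t'.1)⁻¹ := by
      rw [mul_inv_rev, ← eq_inv_of_mul_eq_one_left (tildeSet_mul_self cs I t.2),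
        ← eq_inv_of_mul_eq_one_left (tildeSet_mul_self cs I t'.2)]
    rw [h, orderOf_inv]
  diagonal t := by rw [tildeSet_mul_self cs I t.2, orderOf_one]
  off_diagonal t t' h h1 := by
    rw [orderOf_eq_one_iff] at h1
    apply h
    ext
    rw [eq_inv_of_mul_eq_one_left h1, ← eq_inv_of_mul_eq_one_left (tildeSet_mul_self cs I t'.2)]

/-- The abstract Coxeter group with the matrix of `(W̃, J̃)` maps to `W`. -/
noncomputable def tildeHom : (tildeMatrix cs I).Group →* W :=
  (tildeMatrix cs I).toCoxeterSystem.lift ⟨fun t => t.1, fun _ _ => pow_orderOf_eq_one _⟩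

theorem tildeHom_simple (t : tildeSet cs I) :
    tildeHom cs I ((tildeMatrix cs I).toCoxeterSystem.simple t) = t.1 :=
  CoxeterSystem.lift_apply_simple _ _ _

/-- Conjugation by `x ∈ W_I` on `J̃`. -/
def conjSet (x : parabolic cs I) (t : tildeSet cs I) : tildeSet cs I :=
  ⟨x.1 * t.1 * x.1⁻¹, tildeSet_conj cs I x.2 t.2⟩

noncomputable def conjHom (x : parabolic cs I) :
    (tildeMatrix cs I).Group →* (tildeMatrix cs I).Group :=
  (tildeMatrix cs I).toCoxeterSystem.lift
    ⟨fun t => (tildeMatrix cs I).toCoxeterSystem.simple (conjSet cs I x t), fun t t' => by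
      have h : tildeMatrix cs I t t' = tildeMatrix cs I (conjSet cs I x t) (conjSet cs I x t') := by
        change orderOf (t.1 * t'.1) = orderOf ((x.1 * t.1 * x.1⁻¹) * (x.1 * t'.1 * x.1⁻¹))
        have : (x.1 * t.1 * x.1⁻¹) * (x.1 * t'.1 * x.1⁻¹) = MulAut.conj x.1 (t.1 * t'.1) := by
          rw [MulAut.conj_apply]; group
        rw [this, MulEquiv.orderOf_eq]
      rw [h]
      exact CoxeterSystem.simple_mul_simple_pow _ _ _⟩

theorem conjHom_simple (x : parabolic cs I) (t : tildeSet cs I) :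
    conjHom cs I x ((tildeMatrix cs I).toCoxeterSystem.simple t) =
      (tildeMatrix cs I).toCoxeterSystem.simple (conjSet cs I x t) :=
  CoxeterSystem.lift_apply_simple _ _ _

theorem conjHom_mul (x y : parabolic cs I) :
    conjHom cs I (x * y) = (conjHom cs I x).comp (conjHom cs I y) := by
  refine (tildeMatrix cs I).toCoxeterSystem.ext_simple fun t => ?_
  rw [MonoidHom.comp_apply, conjHom_simple, conjHom_simple, conjHom_simple]
  congr 1
  ext
  simp [conjSet, mul_assoc]

theorem conjHom_one : conjHom cs I 1 = MonoidHom.id _ := by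
  refine (tildeMatrix cs I).toCoxeterSystem.ext_simple fun t => ?_
  rw [MonoidHom.id_apply, conjHom_simple]
  congr 1
  ext
  simp [conjSet]

/-- The action of `W_I` on the abstract Coxeter group. -/
noncomputable def conjAut : parabolic cs I →* MulAut (tildeMatrix cs I).Group where
  toFun x := MonoidHom.toMulEquiv (conjHom cs I x) (conjHom cs I x⁻¹)
    (by rw [← conjHom_mul, inv_mul_cancel, conjHom_one])
    (by rw [← conjHom_mul, mul_inv_cancel, conjHom_one])
  map_one' := by
    ext w
    exact DFunLike.congr_fun (conjHom_one cs I) w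
  map_mul' x y := by
    ext w
    exact DFunLike.congr_fun (conjHom_mul cs I x y) w

theorem conjAut_simple (x : parabolic cs I) (t : tildeSet cs I) :
    conjAut cs I x ((tildeMatrix cs I).toCoxeterSystem.simple t) =
      (tildeMatrix cs I).toCoxeterSystem.simple (conjSet cs I x t) :=
  conjHom_simple cs I x t

theorem even_of_notConj (hI : NotConj cs I) {i j : B} (hi : i ∈ I) (hj : j ∉ I) : Even (M i j) := by
  by_contra h
  rw [Nat.not_even_iff_odd] at h
  obtain ⟨k, hk⟩ := h
  apply hI i hi j hj
  have h1 := cs.simple_mul_simple_pow i j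
  set r := cs.simple i * cs.simple j with hr
  have h2 : ∀ k, cs.simple j * r ^ k = (r ^ k)⁻¹ * cs.simple j := by
    intro k
    induction k with
    | zero => simp
    | succ m ihm =>
      have h1 : cs.simple j * r = r⁻¹ * cs.simple j := by simp [hr, mul_assoc]
      rw [pow_succ, ← mul_assoc, ihm, mul_assoc, h1, ← mul_assoc, ← mul_inv_rev, ← pow_succ',
        ← pow_succ]
  rw [isConj_iff]
  refine ⟨r ^ k, ?_⟩
  have h3 : r ^ k * r ^ k * cs.simple i * cs.simple j = 1 := by
    rw [mul_assoc, ← hr, ← pow_add, ← pow_succ, ← h1, hk]; congr 1; ring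
  have h4 : cs.simple i = (r ^ k)⁻¹ * ((r ^ k)⁻¹ * cs.simple j) := by
    have h5 := eq_inv_of_mul_eq_one_left h3
    rw [cs.inv_simple] at h5
    rw [← h5]; group
  rw [h4, mul_inv_cancel_left, ← h2, mul_inv_cancel_right]

variable {I} in
theorem simple_mem_parabolic {i : B} (h : i ∈ I) : cs.simple i ∈ parabolic cs I :=
  Subgroup.subset_closure ⟨i, h, rfl⟩

variable {I} in
theorem simple_mem_tildeSet {j : B} (h : j ∉ I) : cs.simple j ∈ tildeSet cs I :=
  ⟨1, one_mem _, j, h, by simp⟩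

open Classical in
/-- The images of the simple reflections in the semidirect product of the abstract Coxeter group of
`(W̃, J̃)` with `W_I`. -/
noncomputable def splitFun (i : B) : (tildeMatrix cs I).Group ⋊[conjAut cs I] parabolic cs I :=
  if h : i ∈ I then
    SemidirectProduct.inr ⟨cs.simple i, simple_mem_parabolic cs h⟩
  else
    SemidirectProduct.inl ((tildeMatrix cs I).toCoxeterSystem.simple
      ⟨cs.simple i, simple_mem_tildeSet cs h⟩)

theorem pow_mul_swap {G : Type*} [Group G] {a b : G} {n : ℕ} (h : (a * b) ^ n = 1) :
    (b * a) ^ n = 1 := by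
  have : b * a = a⁻¹ * (a * b) * a⁻¹⁻¹ := by group
  rw [this, conj_pow, h]; simp

theorem tilde_pow {t t' : tildeSet cs I} {n : ℕ} (h : (t.1 * t'.1) ^ n = 1) :
    ((tildeMatrix cs I).toCoxeterSystem.simple t *
      (tildeMatrix cs I).toCoxeterSystem.simple t') ^ n = 1 := by
  obtain ⟨k, hk⟩ : tildeMatrix cs I t t' ∣ n := orderOf_dvd_of_pow_eq_one h
  rw [hk, pow_mul, CoxeterSystem.simple_mul_simple_pow, one_pow]

theorem splitFun_mixed (hI : NotConj cs I) {i j : B} (hi : i ∈ I) (hj : j ∉ I) :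
    (splitFun cs I i * splitFun cs I j) ^ M i j = 1 := by
  obtain ⟨k, hk⟩ := even_of_notConj cs I hI hi hj
  have h1 := cs.simple_mul_simple_pow i j
  rw [hk, ← two_mul, pow_mul] at h1 ⊢
  rw [splitFun, splitFun, dif_pos hi, dif_neg hj]
  set x : parabolic cs I := ⟨cs.simple i, simple_mem_parabolic cs hi⟩ with hx
  set t : tildeSet cs I := ⟨cs.simple j, simple_mem_tildeSet cs hj⟩ with ht
  have hxx : x * x = 1 := by ext; simp [hx]
  have h2 : ((SemidirectProduct.inr x * SemidirectProduct.inl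
      ((tildeMatrix cs I).toCoxeterSystem.simple t)) ^ 2 :
        (tildeMatrix cs I).Group ⋊[conjAut cs I] parabolic cs I) =
      SemidirectProduct.inl ((tildeMatrix cs I).toCoxeterSystem.simple (conjSet cs I x t) *
        (tildeMatrix cs I).toCoxeterSystem.simple t) := by
    have hxi : x = x⁻¹ := eq_inv_of_mul_eq_one_left hxx
    rw [map_mul, ← conjAut_simple, SemidirectProduct.inl_aut, pow_two, ← hxi]
    simp only [mul_assoc]
  rw [h2, ← map_pow, tilde_pow, map_one]
  rw [← h1]
  congr 1
  simp [conjSet, hx, ht, pow_two, mul_assoc]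

theorem splitFun_liftable (hI : NotConj cs I) : M.IsLiftable (splitFun cs I) := by
  intro i j
  by_cases hi : i ∈ I <;> by_cases hj : j ∈ I
  · rw [splitFun, splitFun, dif_pos hi, dif_pos hj, ← map_mul, ← map_pow]
    have h : ((⟨cs.simple i, simple_mem_parabolic cs hi⟩ *
        ⟨cs.simple j, simple_mem_parabolic cs hj⟩ : parabolic cs I) ^ M i j) = 1 :=
      Subtype.ext (cs.simple_mul_simple_pow i j)
    rw [h, map_one]
  · exact splitFun_mixed cs I hI hi hj
  · rw [M.symmetric]
    exact pow_mul_swap (splitFun_mixed cs I hI hj hi)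
  · rw [splitFun, splitFun, dif_neg hi, dif_neg hj, ← map_mul, ← map_pow, tilde_pow, map_one]
    exact cs.simple_mul_simple_pow i j

noncomputable def splitHom (hI : NotConj cs I) :
    W →* (tildeMatrix cs I).Group ⋊[conjAut cs I] parabolic cs I :=
  cs.lift ⟨splitFun cs I, splitFun_liftable cs I hI⟩

theorem splitHom_parabolic (hI : NotConj cs I) {x : W} (hx : x ∈ parabolic cs I) :
    splitHom cs I hI x = SemidirectProduct.inr ⟨x, hx⟩ := by
  induction hx using Subgroup.closure_induction with
  | mem t ht =>
    obtain ⟨i, hi, rfl⟩ := ht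
    rw [splitHom, cs.lift_apply_simple, splitFun, dif_pos hi]
  | one => rw [map_one]; exact (map_one SemidirectProduct.inr).symm
  | mul a b _ _ ha hb => rw [map_mul, ha, hb, ← map_mul]; rfl
  | inv a _ ha => rw [map_inv, ha, ← map_inv]; rfl

theorem splitHom_tildeHom (hI : NotConj cs I) :
    (splitHom cs I hI).comp (tildeHom cs I) = SemidirectProduct.inl := by
  refine (tildeMatrix cs I).toCoxeterSystem.ext_simple fun t => ?_
  rw [MonoidHom.comp_apply, tildeHom_simple]
  obtain ⟨t, x, hx, j, hj, rfl⟩ := t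
  simp only [map_mul, map_inv]
  rw [splitHom_parabolic cs I hI hx, splitHom, cs.lift_apply_simple, splitFun, dif_neg hj,
    ← map_inv, ← SemidirectProduct.inl_aut, conjAut_simple]
  rfl

theorem tildeHom_injective (hI : NotConj cs I) : Function.Injective (tildeHom cs I) := by
  intro a b h
  have h1 := congrArg (splitHom cs I hI) h
  rw [← MonoidHom.comp_apply, ← MonoidHom.comp_apply, splitHom_tildeHom] at h1
  exact SemidirectProduct.inl_injective h1

theorem tildeHom_range : (tildeHom cs I).range = tildeGroup cs I := by
  rw [MonoidHom.range_eq_map, ← CoxeterSystem.subgroup_closure_range_simple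
    (tildeMatrix cs I).toCoxeterSystem, MonoidHom.map_closure, tildeGroup, ← Set.range_comp]
  congr 1
  ext t
  constructor
  · rintro ⟨t, rfl⟩
    rw [Function.comp_apply, tildeHom_simple]
    exact t.2
  · intro ht
    exact ⟨⟨t, ht⟩, tildeHom_simple cs I ⟨t, ht⟩⟩

/-- `(W̃, J̃)` is a Coxeter system. -/
noncomputable def tildeSystem (hI : NotConj cs I) :
    CoxeterSystem (tildeMatrix cs I) (tildeGroup cs I) :=
  ⟨((MonoidHom.ofInjective (tildeHom_injective cs I hI)).trans
    (MulEquiv.subgroupCongr (tildeHom_range cs I))).symm⟩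

/-- The simple reflections of `(W̃, J̃)` are the elements of `J̃`. -/
theorem tildeSystem_simple (hI : NotConj cs I) (t : tildeSet cs I) :
    ((tildeSystem cs I hI).simple t : W) = t.1 :=
  tildeHom_simple cs I t

variable {cs} in
/-- The map `φ̃` on `J̃`: `φ̃(x t x⁻¹) = φ(t)` for `x ∈ W_I` and `t ∈ J`. -/
noncomputable def tildeWeight (hI : NotConj cs I) (φ : WeightMap cs Γ) :
    WeightMap (tildeSystem cs I hI) Γ where
  toFun t := φ.toFun t.2.choose_spec.2.choose
  conj_eq t t' h := by
    apply φ.conj_eq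
    have h1 : IsConj t.1 t'.1 := by
      rw [← tildeSystem_simple cs I hI t, ← tildeSystem_simple cs I hI t']
      exact MonoidHom.map_isConj (tildeGroup cs I).subtype h
    have h2 : ∀ t : tildeSet cs I, IsConj (cs.simple t.2.choose_spec.2.choose) t.1 := by
      intro t
      rw [isConj_iff]
      exact ⟨_, t.2.choose_spec.2.choose_spec.2.symm⟩
    exact ((h2 t).trans h1).trans (h2 t').symm

set_option linter.unusedSectionVars false in
variable {cs} in
theorem tildeWeight_apply (hI : NotConj cs I) (φ : WeightMap cs Γ) (t : tildeSet cs I)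
    {x : W} {j : B} (h : t.1 = x * cs.simple j * x⁻¹) :
    (tildeWeight I hI φ).toFun t = φ.toFun j := by
  apply φ.conj_eq
  have h2 : IsConj (cs.simple t.2.choose_spec.2.choose) t.1 := by
    rw [isConj_iff]
    exact ⟨_, t.2.choose_spec.2.choose_spec.2.symm⟩
  refine h2.trans (IsConj.symm ?_)
  rw [isConj_iff]
  exact ⟨x, h.symm⟩

/-- The action of `x ∈ W_I` on `W̃` by conjugation. -/
def conjTilde (x : parabolic cs I) : tildeGroup cs I ≃* tildeGroup cs I where
  toFun w := ⟨x.1 * w.1 * x.1⁻¹, tildeGroup_conj cs I x.2 w.2⟩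
  invFun w := ⟨x.1⁻¹ * w.1 * x.1, by
    have := tildeGroup_conj cs I (inv_mem x.2) w.2
    rwa [inv_inv] at this⟩
  left_inv w := by ext; simp [mul_assoc]
  right_inv w := by ext; simp [mul_assoc]
  map_mul' v w := by ext; simp [mul_assoc]

theorem conjTilde_simple (hI : NotConj cs I) (x : parabolic cs I) (t : tildeSet cs I) :
    conjTilde cs I x ((tildeSystem cs I hI).simple t) =
      (tildeSystem cs I hI).simple (conjSet cs I x t) := by
  ext
  rw [tildeSystem_simple]
  change x.1 * ((tildeSystem cs I hI).simple t : W) * x.1⁻¹ = _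
  rw [tildeSystem_simple]
  rfl

variable {cs}

/-- The Hecke algebra `H(W̃, J̃, φ̃)`. -/
abbrev TildeHecke (hI : NotConj cs I) (φ : WeightMap cs Γ) : Type _ :=
  Hecke (tildeSystem cs I hI) (tildeWeight I hI φ)

/-- The action of `W_I` on `H(W̃, J̃, φ̃)`: `x` sends `T_w` to `T_{x w x⁻¹}`. -/
noncomputable instance (hI : NotConj cs I) (φ : WeightMap cs Γ) :
    MulSemiringAction (parabolic cs I) (TildeHecke I hI φ) where
  smul x h := Hecke.permMap _ _ (conjTilde cs I x) h
  one_smul h := by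
    change Hecke.permMap _ _ (conjTilde cs I 1) h = h
    induction h using Hecke.induction_T with
    | h0 => exact map_zero _
    | hadd x y hx hy => rw [map_add, hx, hy]
    | hsmul a x hx => rw [map_smul, hx]
    | hT w =>
      rw [Hecke.permMap_T]; congr 1; ext; simp [conjTilde]
  mul_smul x y h := by
    change Hecke.permMap _ _ (conjTilde cs I (x * y)) h =
      Hecke.permMap _ _ (conjTilde cs I x) (Hecke.permMap _ _ (conjTilde cs I y) h)
    induction h using Hecke.induction_T with
    | h0 => simp only [map_zero]
    | hadd x y hx hy => simp only [map_add, hx, hy]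
    | hsmul a x hx => simp only [map_smul, hx]
    | hT w =>
      simp only [Hecke.permMap_T]; congr 1; ext; simp [conjTilde, mul_assoc]
  smul_zero x := map_zero (Hecke.permMap _ _ (conjTilde cs I x))
  smul_add x := map_add (Hecke.permMap _ _ (conjTilde cs I x))
  smul_one x := by
    change Hecke.permMap _ _ (conjTilde cs I x) (1 : TildeHecke I hI φ) = 1
    rw [Hecke.one_def, Hecke.permMap_T, map_one]
  smul_mul x := by
    refine Hecke.permMap_mul _ _ (conjTilde cs I x) (fun t => ?_) (fun t => ?_)
    · refine ⟨conjSet cs I x t, conjTilde_simple cs I hI x t, ?_⟩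
      obtain ⟨t, y, hy, j, hj, rfl⟩ := t
      rw [tildeWeight_apply I hI φ _ (x := y) (j := j) rfl,
        tildeWeight_apply I hI φ _ (x := x.1 * y) (j := j) (by simp [conjSet, mul_assoc])]
    · refine ⟨conjSet cs I x⁻¹ t, ?_⟩
      rw [MulEquiv.symm_apply_eq, conjTilde_simple]
      congr 1
      ext; simp [conjSet, mul_assoc]

theorem smul_T (hI : NotConj cs I) (φ : WeightMap cs Γ) (x : parabolic cs I)
    (w : tildeGroup cs I) : x • (Hecke.T _ _ w : TildeHecke I hI φ) =
      Hecke.T _ _ (conjTilde cs I x w) :=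
  Hecke.permMap_T _ _ _ _

instance (hI : NotConj cs I) (φ : WeightMap cs Γ) :
    SMulCommClass (parabolic cs I) (GroupRing Γ) (TildeHecke I hI φ) :=
  ⟨fun x a h => map_smul (Hecke.permMap _ _ (conjTilde cs I x)) a h⟩

/-- The semidirect product of algebras `W_I ⋉ H(W̃, J̃, φ̃)`, in which `x h x⁻¹ = x(h)`. -/
abbrev SemidirectHecke (hI : NotConj cs I) (φ : WeightMap cs Γ) : Type _ :=
  SkewMonoidAlgebra (TildeHecke I hI φ) (parabolic cs I)

/-- The element `x ∈ W_I` of `W_I ⋉ H(W̃, J̃, φ̃)`. -/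
noncomputable def groupElt (hI : NotConj cs I) (φ : WeightMap cs Γ) (x : parabolic cs I) :
    SemidirectHecke I hI φ := SkewMonoidAlgebra.single x 1

/-- The inclusion of `H(W̃, J̃, φ̃)` in `W_I ⋉ H(W̃, J̃, φ̃)`. -/
noncomputable def inclHecke (hI : NotConj cs I) (φ : WeightMap cs Γ) :
    TildeHecke I hI φ →ₐ[GroupRing Γ] SemidirectHecke I hI φ where
  toRingHom := SkewMonoidAlgebra.singleOneRingHom
  commutes' _ := rfl

end Tilde
end KLHecke

/-! As no element of `I` is conjugate to one of `J`, `W` is the semidirect product of `W̃` and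
`W_I`; this is what `splitHom` provides. Since `φ` vanishes on `I`, the relation for `s ∈ I` is
`T_s² = 1`. Hence `T_x T_w = T_{xw}` and `T_w T_x = T_{wx}` for all `x ∈ W_I` and `w ∈ W`, whatever
the lengths (`parabolic_T_mul_T`, `T_mul_parabolic_T`). Such a `T_x` is fixed by bar and permutes
the basis, so the statements on `C_{xw}` and `C_{wx}` follow from uniqueness of Kazhdan–Lusztig
elements.

The substantial point is that `T_w ↦ T_w` embeds `H(W̃, J̃, φ̃)` in `H(W, S, φ)` as an algebra. For
`t = x s x⁻¹` in `J̃` one has `T_t T_w = T_x (T_s T_{x⁻¹w})`, so the two multiplication rules agree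
as soon as `t` is a left descent of `w` in `W̃` exactly when `s` is a left descent of `x⁻¹ w` in `W`
(`tilde_length_lt_iff`).

This comparison of descents avoids comparing length functions. Descents are read off from the action
of `W` on `W × ℤ/2` by conjugation with a sign that records inversions. An element of `W_I` changes
no sign over `W̃`, because the reflections in `I` are not in `W̃`; so on generators, and hence
everywhere, the action of `W̃` on `W̃ × ℤ/2` is the restriction of that of `W` (`signHom_tilde`).

The embedding commutes with bar and preserves coefficients, hence carries `C_w` to `C_w`. Together
with `x ↦ T_x` it gives `θ`, which is bijective because every element of `W` is uniquely `w x` with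
`w ∈ W̃` and `x ∈ W_I`. -/

namespace KLHecke

/-! ### Descents read off from the sign action on `W × ℤ/2` -/

section Descent

variable {B W : Type*} [Group W] {M : CoxeterMatrix B} (cs : CoxeterSystem M W)

/-- A right descent is detected by the action of `W` on `W × ℤ/2`. -/
theorem length_mul_simple_lt_iff (w : W) (i : B) :
    cs.length (w * cs.simple i) < cs.length w ↔ (signHom cs w (cs.simple i, 0)).2 = 1 := by
  classical
  obtain ⟨ω, hω, rfl⟩ := cs.exists_isReduced w
  rw [signHom_wordProd, zero_add]
  constructor
  · intro h
    rw [List.count_eq_one_of_mem hω.nodup_rightInvSeq (mem_rightInvSeq cs h), Nat.cast_one]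
  · intro h
    refine (cs.isRightInversion_of_mem_rightInvSeq hω ?_).2
    by_contra hn
    rw [List.count_eq_zero_of_not_mem hn] at h
    simp at h

/-- A left descent is detected by the action of `W` on `W × ℤ/2`. -/
theorem length_simple_mul_lt_iff (w : W) (i : B) :
    cs.length (cs.simple i * w) < cs.length w ↔ (signHom cs w⁻¹ (cs.simple i, 0)).2 = 1 := by
  rw [← length_mul_simple_lt_iff, cs.length_inv, ← cs.length_inv (_ * _), mul_inv_rev,
    cs.inv_simple]

theorem signHom_simple [DecidableEq W] (i : B) (p : W × ZMod 2) :
    signHom cs (cs.simple i) p =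
      (cs.simple i * p.1 * cs.simple i, p.2 + if p.1 = cs.simple i then 1 else 0) := by
  rw [signHom, cs.lift_apply_simple, signOp]
  congr

end Descent

/-! ### `W` as a semidirect product of `W̃` and `W_I`, and the comparison of descents -/

section Split

variable {B W : Type*} [Group W] {M : CoxeterMatrix B} (cs : CoxeterSystem M W) (I : Set B)

/-- The projection of `W` onto `W_I` with kernel `W̃`. -/
noncomputable def parabolicProj (hI : NotConj cs I) : W →* parabolic cs I :=
  SemidirectProduct.rightHom.comp (splitHom cs I hI)

theorem parabolicProj_of_mem (hI : NotConj cs I) (x : parabolic cs I) :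
    parabolicProj cs I hI x = x := by
  rw [parabolicProj, MonoidHom.comp_apply, splitHom_parabolic cs I hI x.2]
  rfl

theorem parabolicProj_tilde (hI : NotConj cs I) {w : W} (hw : w ∈ tildeGroup cs I) :
    parabolicProj cs I hI w = 1 := by
  rw [← tildeHom_range] at hw
  obtain ⟨v, rfl⟩ := hw
  rw [parabolicProj, MonoidHom.comp_apply, ← MonoidHom.comp_apply (splitHom cs I hI),
    splitHom_tildeHom]
  rfl

/-- This gives `W = W̃ W_I`. With `p` the projection, `vw p(vw)⁻¹` is `v p(v)⁻¹` times the conjugate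
of `w p(w)⁻¹` by `p(v)`, and `W_I` normalises `W̃`; so the property passes from generators to
products. -/
theorem mul_parabolicProj_inv_mem (hI : NotConj cs I) (w : W) :
    w * (parabolicProj cs I hI w : W)⁻¹ ∈ tildeGroup cs I := by
  induction w using cs.simple_induction with
  | simple i =>
    by_cases hi : i ∈ I
    · rw [parabolicProj_of_mem cs I hI ⟨_, simple_mem_parabolic cs hi⟩, mul_inv_cancel]
      exact one_mem _
    · have h : cs.simple i ∈ tildeGroup cs I := Subgroup.subset_closure (simple_mem_tildeSet cs hi)
      rw [parabolicProj_tilde cs I hI h]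
      simpa using h
  | one => simp
  | mul v w hv hw =>
    have := mul_mem hv (tildeGroup_conj cs I (parabolicProj cs I hI v).2 hw)
    rw [map_mul, Subgroup.coe_mul]
    convert this using 1
    group

/-- The projection is the identity on `W_I` and trivial on `W̃`. -/
theorem eq_one_of_mem_parabolic_of_mem_tildeGroup (hI : NotConj cs I) {w : W}
    (hw : w ∈ parabolic cs I) (hw' : w ∈ tildeGroup cs I) : w = 1 := by
  have h := parabolicProj_of_mem cs I hI ⟨w, hw⟩
  rw [parabolicProj_tilde cs I hI hw'] at h
  exact (congrArg Subtype.val h).symm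

/-- No element of `W̃` is an inversion of an element of `W_I`. -/
theorem signHom_parabolic (hI : NotConj cs I) {x : W} (hx : x ∈ parabolic cs I) {t : W}
    (ht : t ∈ tildeGroup cs I) (e : ZMod 2) : signHom cs x (t, e) = (x * t * x⁻¹, e) := by
  classical
  induction hx using Subgroup.closure_induction generalizing t with
  | mem y hy =>
    obtain ⟨i, hi, rfl⟩ := hy
    rw [signHom_simple, if_neg, cs.inv_simple, add_zero]
    -- A sign change would require `t` to be the simple reflection itself, which would then lie in
    -- `W_I ∩ W̃ = 1`, although its length is `1`.
    rintro rfl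
    have h := eq_one_of_mem_parabolic_of_mem_tildeGroup cs I hI (simple_mem_parabolic cs hi) ht
    have := cs.length_simple i
    rw [h, cs.length_one] at this
    omega
  | one => rw [map_one]; simp [end_one_apply]
  | mul a b ha hb iha ihb =>
    rw [map_mul, end_mul_apply, ihb ht, iha (tildeGroup_conj cs I hb ht)]
    congr 1
    group
  | inv a ha iha =>
    -- The hypothesis for `a` is used at `a⁻¹ t a`, which is still in `W̃`, and then undone by
    -- acting with `a⁻¹`.
    have h := tildeGroup_conj cs I (inv_mem ha) ht
    have h1 := iha h
    have h2 : signHom cs a⁻¹ (signHom cs a (a⁻¹ * t * a⁻¹⁻¹, e)) = (a⁻¹ * t * a⁻¹⁻¹, e) := by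
      rw [← end_mul_apply (signHom cs a⁻¹) (signHom cs a), ← map_mul, inv_mul_cancel, map_one,
        end_one_apply]
    rw [h1] at h2
    rw [← h2]
    group

/-- The action of `W̃` on `W̃ × ℤ/2` is the restriction of that of `W` on `W × ℤ/2`. -/
theorem signHom_tilde (hI : NotConj cs I) (w t : tildeGroup cs I) (e : ZMod 2) :
    signHom cs (w : W) (t, e) =
      (((signHom (tildeSystem cs I hI) w (t, e)).1 : W),
        (signHom (tildeSystem cs I hI) w (t, e)).2) := by
  classical
  induction w using (tildeSystem cs I hI).simple_induction generalizing t e with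
  | simple s =>
    rw [signHom_simple, tildeSystem_simple]
    have hs := tildeSystem_simple cs I hI s
    have hss := tildeSet_mul_self cs I s.2
    simp only [Subtype.ext_iff, Subgroup.coe_mul, hs]
    obtain ⟨s, x, hx, j, hj, rfl⟩ := s
    simp only at hs hss ⊢
    have h1 := tildeGroup_conj cs I (inv_mem hx) t.2
    have h2 : cs.simple j ∈ tildeGroup cs I :=
      Subgroup.subset_closure (simple_mem_tildeSet cs hj)
    -- The generator is `x s x⁻¹`. The outer factors leave the sign alone, and the middle one flips
    -- it exactly when `x⁻¹ t x = s`, which is the condition `t = x s x⁻¹` for the generator of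
    -- `W̃`.
    rw [map_mul, map_mul, end_mul_apply, end_mul_apply, signHom_parabolic cs I hI (inv_mem hx) t.2,
      signHom_simple, signHom_parabolic cs I hI hx (mul_mem (mul_mem h2 h1) h2)]
    have h3 : x⁻¹ * (t : W) * x⁻¹⁻¹ = cs.simple j ↔ (t : W) = x * cs.simple j * x⁻¹ := by
      constructor
      · intro h; rw [← h]; group
      · intro h; rw [h]; group
    simp only [h3]
    congr 1
    group
  | one => simp [end_one_apply]
  | mul v w hv hw =>
    rw [Subgroup.coe_mul, map_mul, map_mul, end_mul_apply, end_mul_apply, hw, hv]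

/-- For `w ∈ W̃` and `t = x s x⁻¹` in `J̃`, the element `t` is a left descent of `w` in `W̃` if and
only if `s` is a left descent of `x⁻¹ w` in `W`. -/
theorem tilde_length_lt_iff (hI : NotConj cs I) (w : tildeGroup cs I) (t : tildeSet cs I)
    {x : W} (hx : x ∈ parabolic cs I) {j : B} (hj : j ∉ I) (ht : t.1 = x * cs.simple j * x⁻¹) :
    (tildeSystem cs I hI).length ((tildeSystem cs I hI).simple t * w) <
        (tildeSystem cs I hI).length w ↔
      cs.length (cs.simple j * (x⁻¹ * w)) < cs.length (x⁻¹ * w) := by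
  -- Since `(x⁻¹ w)⁻¹ = w⁻¹ x` and `x` sends `(s, 0)` to `(t, 0)`, both conditions concern the sign
  -- of `w⁻¹` at `(t, 0)`.
  rw [length_simple_mul_lt_iff, length_simple_mul_lt_iff, mul_inv_rev, inv_inv, map_mul,
    end_mul_apply, signHom_parabolic cs I hI hx
      (Subgroup.subset_closure (simple_mem_tildeSet cs hj)), ← ht,
    ← tildeSystem_simple cs I hI t, ← Subgroup.coe_inv, signHom_tilde cs I hI]

end Split

/-! ### Multiplication by `T_x` for `x ∈ W_I` when `φ` vanishes on `I` -/

section ZeroWeight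

variable {B W Γ : Type*} [Group W] {M : CoxeterMatrix B} [AddCommGroup Γ]
variable {cs : CoxeterSystem M W} {I : Set B} {φ : WeightMap cs Γ}

/-- Left multiplication by `h` commutes with `rightOp`; evaluating at `T_1` identifies that operator
with right multiplication by `T_s`. -/
theorem mul_T_simple (i : B) (h : Hecke cs φ) :
    h * Hecke.T cs φ (cs.simple i) = Hecke.rightOp cs φ i h := by
  have h1 := Hecke.leftMul_commute cs φ h i (Hecke.T cs φ 1)
  rwa [Hecke.leftMul_one, Hecke.rightOp_up cs φ (by simp), one_mul] at h1

theorem xi_eq_zero {i : B} (hi : φ.toFun i = 0) : Hecke.xi cs φ i = 0 := by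
  rw [Hecke.xi, hi, neg_zero, sub_self]

/-- The ascending and descending rules differ only by the term `ξ_s T_w`, and `ξ_s = 0`. No length
condition is left. -/
theorem T_simple_mul_T {i : B} (hi : φ.toFun i = 0) (w : W) :
    Hecke.T cs φ (cs.simple i) * Hecke.T cs φ w = Hecke.T cs φ (cs.simple i * w) := by
  rw [Hecke.T_simple_mul]
  rcases Hecke.lt_or_gt_left cs i w with h | h
  · exact Hecke.leftOp_up cs φ h
  · rw [Hecke.leftOp_down cs φ h, xi_eq_zero hi, zero_smul, add_zero]

theorem T_mul_T_simple {i : B} (hi : φ.toFun i = 0) (w : W) :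
    Hecke.T cs φ w * Hecke.T cs φ (cs.simple i) = Hecke.T cs φ (w * cs.simple i) := by
  rw [mul_T_simple]
  rcases Hecke.lt_or_gt_right cs i w with h | h
  · exact Hecke.rightOp_up cs φ h
  · rw [Hecke.rightOp_down cs φ h, xi_eq_zero hi, zero_smul, add_zero]

theorem parabolic_T_mul_T (hφ : ∀ i ∈ I, φ.toFun i = 0) {x : W} (hx : x ∈ parabolic cs I) (w : W) :
    Hecke.T cs φ x * Hecke.T cs φ w = Hecke.T cs φ (x * w) := by
  induction hx using Subgroup.closure_induction generalizing w with
  | mem y hy =>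
    obtain ⟨i, hi, rfl⟩ := hy
    exact T_simple_mul_T (hφ i hi) w
  | one => rw [← Hecke.one_def, one_mul, one_mul]
  | mul a b _ _ ha hb => rw [← ha, mul_assoc, hb, ha, mul_assoc]
  | inv a _ ha =>
    -- Multiplying by the unit `T_a` reduces the claim for `a⁻¹` to two instances of the claim for
    -- `a`.
    refine (Hecke.isUnit_T cs φ a).mul_left_cancel ?_
    rw [← mul_assoc, ha, ha, mul_inv_cancel, mul_inv_cancel_left, ← Hecke.one_def, one_mul]

theorem T_mul_parabolic_T (hφ : ∀ i ∈ I, φ.toFun i = 0) {x : W} (hx : x ∈ parabolic cs I) (w : W) :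
    Hecke.T cs φ w * Hecke.T cs φ x = Hecke.T cs φ (w * x) := by
  induction hx using Subgroup.closure_induction generalizing w with
  | mem y hy =>
    obtain ⟨i, hi, rfl⟩ := hy
    exact T_mul_T_simple (hφ i hi) w
  | one => rw [← Hecke.one_def, mul_one, mul_one]
  | mul a b _ _ ha hb => rw [← hb, ← mul_assoc, ha, hb, mul_assoc]
  | inv a _ ha =>
    refine (Hecke.isUnit_T cs φ a).mul_right_cancel ?_
    rw [mul_assoc, ha, ha, inv_mul_cancel, inv_mul_cancel_right, ← Hecke.one_def, mul_one]

/-- The `T_x` with `x ∈ W_I` multiply as in the group `W_I`. -/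
noncomputable def parabolicT (hφ : ∀ i ∈ I, φ.toFun i = 0) : parabolic cs I →* Hecke cs φ where
  toFun x := Hecke.T cs φ x
  map_one' := rfl
  map_mul' x y := (parabolic_T_mul_T hφ x.2 y).symm

/-- Bar sends `T_x` to the inverse of `T_{x⁻¹}`, which is `T_x` because these elements multiply as
in the group. -/
theorem bar_parabolic_T (hφ : ∀ i ∈ I, φ.toFun i = 0) {x : W} (hx : x ∈ parabolic cs I) :
    Hecke.bar cs φ (Hecke.T cs φ x) = Hecke.T cs φ x := by
  rw [Hecke.bar_T]
  refine Ring.inverse_unit ⟨Hecke.T cs φ x⁻¹, Hecke.T cs φ x, ?_, ?_⟩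
  · rw [T_mul_parabolic_T hφ hx, inv_mul_cancel, Hecke.one_def]
  · rw [parabolic_T_mul_T hφ hx, mul_inv_cancel, Hecke.one_def]

theorem coeff_smul (a : GroupRing Γ) (h : Hecke cs φ) (w : W) :
    Hecke.coeff cs φ (a • h) w = a * Hecke.coeff cs φ h w := by
  simp [Hecke.coeff]

theorem coeff_zero (w : W) : Hecke.coeff cs φ 0 w = 0 := by
  simp [Hecke.coeff]

/-- Left multiplication by `T_x` only permutes the basis. In particular it preserves the condition
that all coefficients lie in `ℤ[Γ_{<0}]`. -/
theorem coeff_parabolic_T_mul (hφ : ∀ i ∈ I, φ.toFun i = 0) {x : W} (hx : x ∈ parabolic cs I)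
    (h : Hecke cs φ) (w : W) :
    Hecke.coeff cs φ (Hecke.T cs φ x * h) w = Hecke.coeff cs φ h (x⁻¹ * w) := by
  classical
  induction h using Hecke.induction_T with
  | h0 => rw [mul_zero, coeff_zero, coeff_zero]
  | hadd a b ha hb => rw [mul_add, Hecke.coeff_add, Hecke.coeff_add, ha, hb]
  | hsmul a b hb => rw [mul_smul_comm, coeff_smul, coeff_smul, hb]
  | hT v =>
    rw [parabolic_T_mul_T hφ hx, Hecke.coeff_T, Hecke.coeff_T]
    simp only [eq_inv_mul_iff_mul_eq]

theorem coeff_mul_parabolic_T (hφ : ∀ i ∈ I, φ.toFun i = 0) {x : W} (hx : x ∈ parabolic cs I)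
    (h : Hecke cs φ) (w : W) :
    Hecke.coeff cs φ (h * Hecke.T cs φ x) w = Hecke.coeff cs φ h (w * x⁻¹) := by
  classical
  induction h using Hecke.induction_T with
  | h0 => rw [zero_mul, coeff_zero, coeff_zero]
  | hadd a b ha hb => rw [add_mul, Hecke.coeff_add, Hecke.coeff_add, ha, hb]
  | hsmul a b hb => rw [smul_mul_assoc, coeff_smul, coeff_smul, hb]
  | hT v =>
    rw [T_mul_parabolic_T hφ hx, Hecke.coeff_T, Hecke.coeff_T]
    simp only [eq_mul_inv_iff_mul_eq]

variable [LinearOrder Γ] [IsOrderedAddMonoid Γ]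

theorem C_eq_of_isKL {w : W} {c : Hecke cs φ} (h : Hecke.IsKL cs φ w c) : Hecke.C cs φ w = c :=
  (Hecke.existsUnique_isKL cs φ w).unique (Hecke.isKL_C cs φ w) h

theorem C_one : Hecke.C cs φ 1 = 1 := by
  refine C_eq_of_isKL ⟨Hecke.bar_one cs φ, fun w γ h => ?_⟩
  rw [Hecke.one_def, sub_self, coeff_zero] at h
  exact absurd rfl h

/-- The product `T_x C_w` is fixed by bar because both factors are, and its difference from `T_{xw}`
is `T_x (C_w - T_w)`, whose coefficients are those of `C_w - T_w` rearranged. Uniqueness of the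
Kazhdan–Lusztig element concludes. -/
theorem C_parabolic_mul (hφ : ∀ i ∈ I, φ.toFun i = 0) {x : W} (hx : x ∈ parabolic cs I) (w : W) :
    Hecke.C cs φ (x * w) = Hecke.T cs φ x * Hecke.C cs φ w := by
  obtain ⟨h1, h2⟩ := Hecke.isKL_C cs φ w
  refine C_eq_of_isKL ⟨?_, fun v => ?_⟩
  · rw [Hecke.bar_mul, bar_parabolic_T hφ hx, h1]
  · rw [← parabolic_T_mul_T hφ hx, ← mul_sub, coeff_parabolic_T_mul hφ hx]
    exact h2 _

theorem C_mul_parabolic (hφ : ∀ i ∈ I, φ.toFun i = 0) {x : W} (hx : x ∈ parabolic cs I) (w : W) :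
    Hecke.C cs φ (w * x) = Hecke.C cs φ w * Hecke.T cs φ x := by
  obtain ⟨h1, h2⟩ := Hecke.isKL_C cs φ w
  refine C_eq_of_isKL ⟨?_, fun v => ?_⟩
  · rw [Hecke.bar_mul, bar_parabolic_T hφ hx, h1]
  · rw [← T_mul_parabolic_T hφ hx, ← sub_mul, coeff_mul_parabolic_T hφ hx]
    exact h2 _

theorem C_parabolic (hφ : ∀ i ∈ I, φ.toFun i = 0) {x : W} (hx : x ∈ parabolic cs I) :
    Hecke.C cs φ x = Hecke.T cs φ x := by
  rw [← mul_one x, C_parabolic_mul hφ hx, C_one, mul_one, mul_one]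

end ZeroWeight

/-! ### The embedding of `H(W̃, J̃, φ̃)` in `H(W, S, φ)` -/

section Embedding

variable {B W Γ : Type*} [Group W] {M : CoxeterMatrix B} [AddCommGroup Γ]
variable {cs : CoxeterSystem M W} {I : Set B} (hI : NotConj cs I) {φ : WeightMap cs Γ}

variable (φ) in
/-- The linear map `H(W̃, J̃, φ̃) → H(W, S, φ)` with `T_w ↦ T_w`. -/
noncomputable def tildeLinear : TildeHecke I hI φ →ₗ[GroupRing Γ] Hecke cs φ :=
  (Hecke.basis _ _).constr (GroupRing Γ) fun w => Hecke.T cs φ (w : W)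

theorem tildeLinear_T (w : tildeGroup cs I) :
    tildeLinear hI φ (Hecke.T _ _ w) = Hecke.T cs φ (w : W) :=
  Module.Basis.constr_basis _ _ _ _

/-- Here the comparison of descents is used: `T_t T_w` in the small algebra and `T_s T_{x⁻¹w}` in
the large one fall under the same case of the multiplication rule, with the same parameter `ξ`.
Multiplying the latter by `T_x` gives the former. -/
theorem tildeLinear_simple_mul (hφ : ∀ i ∈ I, φ.toFun i = 0) (t : tildeSet cs I)
    (h : TildeHecke I hI φ) :
    tildeLinear hI φ (Hecke.T _ _ ((tildeSystem cs I hI).simple t) * h) =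
      tildeLinear hI φ (Hecke.T _ _ ((tildeSystem cs I hI).simple t)) * tildeLinear hI φ h := by
  induction h using Hecke.induction_T with
  | h0 => rw [mul_zero, map_zero, mul_zero]
  | hadd x y hx hy => rw [mul_add, map_add, hx, hy, map_add, mul_add]
  | hsmul a x hx => rw [mul_smul_comm, map_smul, hx, map_smul, mul_smul_comm]
  | hT w =>
    obtain ⟨x, hx, j, hj, ht⟩ := id t.2
    have hlt := tilde_length_lt_iff cs I hI w t hx hj ht
    have hxi : Hecke.xi (tildeSystem cs I hI) (tildeWeight I hI φ) t = Hecke.xi cs φ j := by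
      rw [Hecke.xi, Hecke.xi, tildeWeight_apply I hI φ t ht]
    -- `T_t = T_x T_s T_{x⁻¹}`, and `T_{x⁻¹}` is absorbed into `T_w`.
    have hT : Hecke.T cs φ t.1 * Hecke.T cs φ w = Hecke.T cs φ x *
        (Hecke.T cs φ (cs.simple j) * Hecke.T cs φ (x⁻¹ * w)) := by
      rw [ht, ← T_mul_parabolic_T hφ (inv_mem hx), ← parabolic_T_mul_T hφ hx,
        ← parabolic_T_mul_T hφ (inv_mem hx), mul_assoc, mul_assoc]
    rw [Hecke.T_simple_mul, tildeLinear_T, tildeLinear_T, tildeSystem_simple, hT,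
      Hecke.T_simple_mul]
    have h1 : x * (cs.simple j * (x⁻¹ * w)) = t.1 * w := by rw [ht]; group
    rcases Hecke.lt_or_gt_left (tildeSystem cs I hI) t w with h | h
    · have h' : cs.length (x⁻¹ * w) < cs.length (cs.simple j * (x⁻¹ * w)) :=
        (Hecke.lt_or_gt_left cs j _).resolve_right fun h2 => lt_asymm h (hlt.2 h2)
      rw [Hecke.leftOp_up _ _ h, Hecke.leftOp_up _ _ h', parabolic_T_mul_T hφ hx, tildeLinear_T,
        Subgroup.coe_mul, tildeSystem_simple, h1]
    · rw [Hecke.leftOp_down _ _ h, Hecke.leftOp_down _ _ (hlt.1 h), mul_add, mul_smul_comm,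
        parabolic_T_mul_T hφ hx, parabolic_T_mul_T hφ hx, map_add, map_smul, tildeLinear_T,
        tildeLinear_T, Subgroup.coe_mul, tildeSystem_simple, h1, mul_inv_cancel_left, hxi]

theorem tildeLinear_mul (hφ : ∀ i ∈ I, φ.toFun i = 0) (x y : TildeHecke I hI φ) :
    tildeLinear hI φ (x * y) = tildeLinear hI φ x * tildeLinear hI φ y := by
  induction x using Hecke.induction_T with
  | h0 => rw [zero_mul, map_zero, zero_mul]
  | hadd x z hx hz => rw [add_mul, map_add, hx, hz, map_add, add_mul]
  | hsmul a x hx => rw [smul_mul_assoc, map_smul, hx, map_smul, smul_mul_assoc]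
  | hT w =>
    induction hn : (tildeSystem cs I hI).length w using Nat.strong_induction_on
      generalizing w with
    | _ n ih =>
      by_cases hw : w = 1
      · rw [hw, tildeLinear_T, ← Hecke.one_def, one_mul, Subgroup.coe_one, ← Hecke.one_def,
          one_mul]
      · obtain ⟨i, v, -, h2, h3⟩ := Hecke.exists_left_factor _ (tildeWeight I hI φ) hw
        rw [h3, mul_assoc, tildeLinear_simple_mul hI hφ, ih _ (by omega) v rfl,
          tildeLinear_simple_mul hI hφ, mul_assoc]

/-- The algebra homomorphism `H(W̃, J̃, φ̃) → H(W, S, φ)` with `T_w ↦ T_w`. -/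
noncomputable def tildeEmbedding (hφ : ∀ i ∈ I, φ.toFun i = 0) :
    TildeHecke I hI φ →ₐ[GroupRing Γ] Hecke cs φ :=
  AlgHom.ofLinearMap (tildeLinear hI φ) (tildeLinear_T hI 1) (tildeLinear_mul hI hφ)

theorem tildeEmbedding_T (hφ : ∀ i ∈ I, φ.toFun i = 0) (w : tildeGroup cs I) :
    tildeEmbedding hI hφ (Hecke.T _ _ w) = Hecke.T cs φ (w : W) :=
  tildeLinear_T hI w

/-- With the vanishing of coefficients outside `W̃`, this determines the image completely; it yields
injectivity and lets negativity of coefficients be transported. -/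
theorem coeff_tildeEmbedding (hφ : ∀ i ∈ I, φ.toFun i = 0) (h : TildeHecke I hI φ)
    (w : tildeGroup cs I) :
    Hecke.coeff cs φ (tildeEmbedding hI hφ h) w = Hecke.coeff _ _ h w := by
  classical
  induction h using Hecke.induction_T with
  | h0 => rw [map_zero, coeff_zero, coeff_zero]
  | hadd x y hx hy => rw [map_add, Hecke.coeff_add, hx, hy, Hecke.coeff_add]
  | hsmul a x hx => rw [map_smul, coeff_smul, hx, coeff_smul]
  | hT v =>
    rw [tildeEmbedding_T, Hecke.coeff_T, Hecke.coeff_T]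
    simp only [Subtype.ext_iff]

theorem coeff_tildeEmbedding_of_notMem (hφ : ∀ i ∈ I, φ.toFun i = 0) (h : TildeHecke I hI φ)
    {w : W} (hw : w ∉ tildeGroup cs I) : Hecke.coeff cs φ (tildeEmbedding hI hφ h) w = 0 := by
  classical
  induction h using Hecke.induction_T with
  | h0 => rw [map_zero, coeff_zero]
  | hadd x y hx hy => rw [map_add, Hecke.coeff_add, hx, hy, add_zero]
  | hsmul a x hx => rw [map_smul, coeff_smul, hx, mul_zero]
  | hT v =>
    rw [tildeEmbedding_T, Hecke.coeff_T, if_neg]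
    rintro rfl
    exact hw v.2

theorem tildeEmbedding_injective (hφ : ∀ i ∈ I, φ.toFun i = 0) :
    Function.Injective (tildeEmbedding hI hφ) := fun x y h =>
  Hecke.coeff_ext _ _ fun w => by
    rw [← coeff_tildeEmbedding hI hφ, h, coeff_tildeEmbedding hI hφ]

theorem range_tildeEmbedding (hφ : ∀ i ∈ I, φ.toFun i = 0) :
    Subalgebra.toSubmodule (tildeEmbedding hI hφ).range =
      Submodule.span (GroupRing Γ)
        (Set.range fun w : tildeGroup cs I => Hecke.T cs φ (w : W)) :=
  (Hecke.basis _ _).constr_range (GroupRing Γ)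

/-- Both involutions send `T_w` to the inverse of `T_{w⁻¹}`, and an algebra homomorphism respects
inverses of units. -/
theorem bar_tildeEmbedding (hφ : ∀ i ∈ I, φ.toFun i = 0) (h : TildeHecke I hI φ) :
    Hecke.bar cs φ (tildeEmbedding hI hφ h) = tildeEmbedding hI hφ (Hecke.bar _ _ h) := by
  induction h using Hecke.induction_T with
  | h0 => simp only [map_zero]
  | hadd x y hx hy => simp only [map_add, hx, hy]
  | hsmul a x hx => rw [map_smul, map_smulₛₗ, hx, map_smulₛₗ, map_smul]
  | hT w =>
    rw [tildeEmbedding_T, Hecke.bar_T, Hecke.bar_T, ← Subgroup.coe_inv, ← tildeEmbedding_T hI hφ]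
    -- `Ring.inverse` is a genuine inverse only at units, so an explicit unit is mapped across.
    obtain ⟨u, hu⟩ := Hecke.isUnit_T (tildeSystem cs I hI) (tildeWeight I hI φ) w⁻¹
    rw [← hu, Ring.inverse_unit]
    exact Ring.inverse_unit (Units.map (tildeEmbedding hI hφ : TildeHecke I hI φ →* Hecke cs φ) u)

theorem tildeEmbedding_C [LinearOrder Γ] [IsOrderedAddMonoid Γ] (hφ : ∀ i ∈ I, φ.toFun i = 0)
    (w : tildeGroup cs I) :
    tildeEmbedding hI hφ (Hecke.C _ _ w) = Hecke.C cs φ (w : W) := by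
  obtain ⟨h1, h2⟩ := Hecke.isKL_C (tildeSystem cs I hI) (tildeWeight I hI φ) w
  refine (C_eq_of_isKL ⟨?_, fun v => ?_⟩).symm
  · rw [bar_tildeEmbedding, h1]
  · rw [← tildeEmbedding_T hI hφ, ← map_sub]
    -- Over `W̃` the coefficients are those of `C_w - T_w` in the small algebra; elsewhere they are
    -- zero, and negativity is vacuous.
    by_cases hv : v ∈ tildeGroup cs I
    · rw [coeff_tildeEmbedding hI hφ _ ⟨v, hv⟩]
      exact h2 _
    · rw [coeff_tildeEmbedding_of_notMem hI hφ _ hv]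
      exact fun γ h => absurd rfl h

/-- This is the relation `x(h) x = x h`, needed to extend the embedding to the semidirect product.
On `h = T_w` both sides are `T_{xw}`. -/
theorem tildeEmbedding_smul (hφ : ∀ i ∈ I, φ.toFun i = 0) (x : parabolic cs I)
    (h : TildeHecke I hI φ) :
    tildeEmbedding hI hφ (x • h) * parabolicT hφ x = parabolicT hφ x * tildeEmbedding hI hφ h := by
  change _ * Hecke.T cs φ (x : W) = Hecke.T cs φ (x : W) * _
  induction h using Hecke.induction_T with
  | h0 => rw [smul_zero, map_zero, zero_mul, mul_zero]
  | hadd a b ha hb => rw [smul_add, map_add, add_mul, ha, hb, map_add, mul_add]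
  | hsmul a b hb => rw [smul_comm, map_smul, smul_mul_assoc, hb, map_smul, mul_smul_comm]
  | hT w =>
    rw [smul_T, tildeEmbedding_T, tildeEmbedding_T, T_mul_parabolic_T hφ x.2,
      parabolic_T_mul_T hφ x.2]
    congr 1
    simp [conjTilde]

/-! ### The isomorphism `θ` -/

/-- The algebra homomorphism `θ` with `x T_w ↦ T_{xw}` for `x ∈ W_I` and `w ∈ W̃`. -/
noncomputable def thetaHom (hφ : ∀ i ∈ I, φ.toFun i = 0) :
    SemidirectHecke I hI φ →ₐ[GroupRing Γ] Hecke cs φ :=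
  SkewMonoidAlgebra.liftNCAlgHom (tildeEmbedding hI hφ) (parabolicT hφ)
    (tildeEmbedding_smul hI hφ _ _)

/-- In the skew monoid algebra coefficients stand to the left: `single x h` is `h x`, not `x h`.
Hence `T_{wx}` rather than `T_{xw}` appears when `h = T_w`. -/
theorem thetaHom_single (hφ : ∀ i ∈ I, φ.toFun i = 0) (x : parabolic cs I)
    (h : TildeHecke I hI φ) :
    thetaHom hI hφ (SkewMonoidAlgebra.single x h) =
      tildeEmbedding hI hφ h * Hecke.T cs φ (x : W) :=
  SkewMonoidAlgebra.liftNC_single _ _ _ _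

theorem thetaHom_single_T (hφ : ∀ i ∈ I, φ.toFun i = 0) (x : parabolic cs I)
    (w : tildeGroup cs I) :
    thetaHom hI hφ (SkewMonoidAlgebra.single x (Hecke.T _ _ w)) = Hecke.T cs φ (w * x : W) := by
  rw [thetaHom_single, tildeEmbedding_T, T_mul_parabolic_T hφ x.2]

theorem thetaHom_inclHecke (hφ : ∀ i ∈ I, φ.toFun i = 0) (h : TildeHecke I hI φ) :
    thetaHom hI hφ (inclHecke I hI φ h) = tildeEmbedding hI hφ h := by
  refine (thetaHom_single hI hφ 1 h).trans ?_
  rw [Subgroup.coe_one, ← Hecke.one_def, mul_one]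

/-- Passes from the convention `x h` of the theorem to the convention `x(h) x` of the skew monoid
algebra. -/
theorem groupElt_mul_inclHecke (x : parabolic cs I) (h : TildeHecke I hI φ) :
    groupElt I hI φ x * inclHecke I hI φ h = SkewMonoidAlgebra.single x (x • h) := by
  refine SkewMonoidAlgebra.single_mul_single.trans ?_
  rw [mul_one, one_mul]

theorem semidirect_hom_ext {N : Type*} [AddCommMonoid N] [Module (GroupRing Γ) N]
    {f g : SemidirectHecke I hI φ →ₗ[GroupRing Γ] N}
    (h : ∀ (x : parabolic cs I) (w : tildeGroup cs I),
      f (SkewMonoidAlgebra.single x (Hecke.T _ _ w)) =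
        g (SkewMonoidAlgebra.single x (Hecke.T _ _ w))) : f = g :=
  SkewMonoidAlgebra.lhom_ext' fun x => (Hecke.basis _ _).ext fun w => h x w

/-- The inverse of `θ`: it maps `T_{wx}` to `T_w x` for `w ∈ W̃` and `x ∈ W_I`. -/
noncomputable def thetaInv : Hecke cs φ →ₗ[GroupRing Γ] SemidirectHecke I hI φ :=
  (Hecke.basis cs φ).constr (GroupRing Γ) fun w =>
    SkewMonoidAlgebra.single (parabolicProj cs I hI w)
      (Hecke.T _ _ ⟨_, mul_parabolicProj_inv_mem cs I hI w⟩)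

theorem thetaInv_T (w : W) : thetaInv hI (Hecke.T cs φ w) =
    SkewMonoidAlgebra.single (parabolicProj cs I hI w)
      (Hecke.T _ (tildeWeight I hI φ) ⟨_, mul_parabolicProj_inv_mem cs I hI w⟩) :=
  Module.Basis.constr_basis _ _ _ _

/-- The isomorphism `θ : W_I ⋉ H(W̃, J̃, φ̃) ≃ H(W, S, φ)`. -/
noncomputable def theta (hφ : ∀ i ∈ I, φ.toFun i = 0) :
    SemidirectHecke I hI φ ≃ₐ[GroupRing Γ] Hecke cs φ :=
  AlgEquiv.ofBijective (thetaHom hI hφ) <| by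
    have h1 : thetaInv hI ∘ₗ (thetaHom hI hφ).toLinearMap = LinearMap.id := by
      refine semidirect_hom_ext hI fun x w => ?_
      rw [LinearMap.comp_apply, AlgHom.toLinearMap_apply, thetaHom_single_T, thetaInv_T,
        LinearMap.id_apply]
      -- The decomposition is unique: the projection of `w x` is `x`, so its component in `W̃` is
      -- `w`.
      have hp : parabolicProj cs I hI (w * x : W) = x := by
        rw [map_mul, parabolicProj_tilde cs I hI w.2, parabolicProj_of_mem, one_mul]
      congr 2
      ext
      simp [hp]
    have h2 : (thetaHom hI hφ).toLinearMap ∘ₗ thetaInv hI = LinearMap.id := by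
      refine (Hecke.basis cs φ).ext fun w => ?_
      change thetaHom hI hφ (thetaInv hI (Hecke.T cs φ w)) = Hecke.T cs φ w
      rw [thetaInv_T, thetaHom_single_T, inv_mul_cancel_right]
    exact ⟨Function.LeftInverse.injective (g := thetaInv hI) (LinearMap.congr_fun h1),
      Function.RightInverse.surjective (g := thetaInv hI) (LinearMap.congr_fun h2)⟩

theorem theta_groupElt_mul (hφ : ∀ i ∈ I, φ.toFun i = 0) (x : parabolic cs I)
    (w : tildeGroup cs I) :
    theta hI hφ (groupElt I hI φ x * inclHecke I hI φ (Hecke.T _ _ w)) =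
      Hecke.T cs φ ((x : W) * (w : W)) := by
  rw [groupElt_mul_inclHecke, smul_T]
  refine (thetaHom_single_T hI hφ x _).trans ?_
  congr 1
  simp [conjTilde]

/-- For fixed `x`, conjugation by `x` permutes `W̃`, so the `x T_w` are the `T_w x` in another order
and also determine a linear map. This gives the uniqueness of `θ`. -/
theorem semidirect_hom_ext' {N : Type*} [AddCommMonoid N] [Module (GroupRing Γ) N]
    {f g : SemidirectHecke I hI φ →ₗ[GroupRing Γ] N}
    (h : ∀ (x : parabolic cs I) (w : tildeGroup cs I),
      f (groupElt I hI φ x * inclHecke I hI φ (Hecke.T _ _ w)) =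
        g (groupElt I hI φ x * inclHecke I hI φ (Hecke.T _ _ w))) : f = g := by
  refine semidirect_hom_ext hI fun x w => ?_
  have h1 := h x ((conjTilde cs I x).symm w)
  rwa [groupElt_mul_inclHecke, smul_T, MulEquiv.apply_symm_apply] at h1

end Embedding

end KLHecke

theorem mainTheorem4 {B W Γ : Type*} [Group W] {M : CoxeterMatrix B} (cs : CoxeterSystem M W)
    [AddCommGroup Γ] [LinearOrder Γ] [IsOrderedAddMonoid Γ]
    (φ : KLHecke.WeightMap cs Γ) (I : Set B) (hI : KLHecke.NotConj cs I)
    (hφ : ∀ i ∈ I, φ.toFun i = 0) :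
    ∃ A : Subalgebra (KLHecke.GroupRing Γ) (KLHecke.Hecke cs φ),
      Subalgebra.toSubmodule A =
        Submodule.span (KLHecke.GroupRing Γ)
          (Set.range fun w : KLHecke.tildeGroup cs I => KLHecke.Hecke.T cs φ (w : W)) ∧
      ∃ θ : KLHecke.SemidirectHecke I hI φ ≃ₐ[KLHecke.GroupRing Γ] KLHecke.Hecke cs φ,
        (∀ (x : KLHecke.parabolic cs I) (w : KLHecke.tildeGroup cs I),
          θ (KLHecke.groupElt I hI φ x * KLHecke.inclHecke I hI φ (KLHecke.Hecke.T _ _ w)) =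
            KLHecke.Hecke.T cs φ ((x : W) * (w : W))) ∧
        (∀ f : KLHecke.SemidirectHecke I hI φ →ₗ[KLHecke.GroupRing Γ] KLHecke.Hecke cs φ,
          (∀ (x : KLHecke.parabolic cs I) (w : KLHecke.tildeGroup cs I),
            f (KLHecke.groupElt I hI φ x * KLHecke.inclHecke I hI φ (KLHecke.Hecke.T _ _ w)) =
              KLHecke.Hecke.T cs φ ((x : W) * (w : W))) →
          f = θ.toLinearMap) ∧
        (∃ e : KLHecke.TildeHecke I hI φ ≃ₐ[KLHecke.GroupRing Γ] A,
          ∀ h, (e h : KLHecke.Hecke cs φ) = θ (KLHecke.inclHecke I hI φ h)) ∧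
        (∀ x ∈ KLHecke.parabolic cs I,
          KLHecke.Hecke.C cs φ x = KLHecke.Hecke.T cs φ x ∧
          ∀ w : W,
            KLHecke.Hecke.C cs φ (x * w) = KLHecke.Hecke.T cs φ x * KLHecke.Hecke.C cs φ w ∧
            KLHecke.Hecke.C cs φ (w * x) = KLHecke.Hecke.C cs φ w * KLHecke.Hecke.T cs φ x) ∧
        (∀ w : KLHecke.tildeGroup cs I,
          θ (KLHecke.inclHecke I hI φ (KLHecke.Hecke.C _ _ w)) =
            KLHecke.Hecke.C cs φ (w : W)) := by
  -- Taking the subalgebra to be the range of the embedding makes closure under products automatic;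
  -- the isomorphism onto it is the embedding with restricted codomain.
  refine ⟨(KLHecke.tildeEmbedding hI hφ).range, KLHecke.range_tildeEmbedding hI hφ,
    KLHecke.theta hI hφ, KLHecke.theta_groupElt_mul hI hφ, fun f hf => ?_,
    ⟨AlgEquiv.ofInjective _ (KLHecke.tildeEmbedding_injective hI hφ), fun h => ?_⟩,
    fun x hx => ⟨KLHecke.C_parabolic hφ hx, fun w =>
      ⟨KLHecke.C_parabolic_mul hφ hx w, KLHecke.C_mul_parabolic hφ hx w⟩⟩, fun w => ?_⟩
  · refine KLHecke.semidirect_hom_ext' hI fun x w => ?_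
    rw [hf]
    exact (KLHecke.theta_groupElt_mul hI hφ x w).symm
  · exact (KLHecke.thetaHom_inclHecke hI hφ h).symm
  · exact (KLHecke.thetaHom_inclHecke hI hφ _).trans (KLHecke.tildeEmbedding_C hI hφ w)
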